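/- Let $\bar S_2$ be the complex Lie algebra of all derivations $p_1\partial_1+p_2\partial_2$ of $\mathbb{C}[t_1,t_2]$ (where $\partial_i=\partial/\partial t_i$) whose divergence $\partial_1(p_1)+\partial_2(p_2)$ is constant. It contains $\partial_1,\partial_2$, the elements $d_i=t_i\partial_i$, and, for every $\alpha=(\alpha_1,\alpha_2)\in\mathbb{Z}^2_{\ge -1}$, the element $$L_\alpha=(1+\alpha_2)\,t^{\alpha+e_1}\partial_1-(1+\alpha_1)\,t^{\alpha+e_2}\partial_2 ,$$ where a term with coefficient $0$ is read as $0$. Let $U_{(-1)}$ be the localization of the universal enveloping algebra $U(\bar S_2)$ at the Ore set $\{\partial_1^{i}\partial_2^{j}\mid i,j\ge 0\}$, and let $$H=\{u\in U_{(-1)}\mid [u,\partial_i]=[u,d_i]=0,\ i=1,2\},$$ a subalgebra of $U_{(-1)}$. Write $|\alpha|=\alpha_1+\alpha_2$, $\partial^\alpha=\partial_1^{\alpha_1}\partial_2^{\alpha_2}$ and $\binom{\alpha+\mathbf 1}{\beta+\mathbf 1}=\binom{\alpha_1+1}{\beta_1+1}\binom{\alpha_2+1}{\beta_2+1}$. For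 $\alpha\in\mathbb{Z}^2_{\ge -1}$ with $|\alpha|\ge 0$ and $\alpha\ne \mathbf 0$ define the following element of $U_{(-1)}$, in which empty products are $1$ and $\beta$ runs over $\mathbb{Z}^2_{\ge -1}$: $$\begin{aligned}Y_\alpha={}&L_\alpha\partial^\alpha+\sum_{0\le|\beta|<|\alpha|,\ \beta\ne\mathbf 0}(-1)^{|\alpha|-|\beta|}\binom{\alpha+\mathbf 1}{\beta+\mathbf 1}L_\beta\prod_{m_1=0}^{\alpha_1-\beta_1-1}(d_1-m_1)\prod_{m_2=0}^{\alpha_2-\beta_2-1}(d_2-m_2)\,\partial^\beta\\&+(-1)^{|\alpha|}\alpha_1(\alpha_2+1)\prod_{i=-1}^{\alpha_1-1}(d_1-i)\prod_{j=0}^{\alpha_2-1}(d_2-j)\\&+(-1)^{|\alpha|-1}(\alpha_1+1)\alpha_2\prod_{i=0}^{\alpha_1-1}(d_1-i)\prod_{j=-1}^{\alpha_2-1}(d_2-j).\end{aligned}$$ Fix any total order on the set of all such $\alpha$. Then the ordered monomials $Y_{\alpha^{(1)}}Y_{\alpha^{(2)}}\cdots Y_{\alpha^{(k)}}$ with $k\ge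 0$ and $\alpha^{(1)}\le\alpha^{(2)}\le\cdots\le\alpha^{(k)}$ lie in $H$ and form a basis of $H$ over $\mathbb{C}$. Moreover, the algebra $H$ is generated by $Y_{(1,-1)}$, $Y_{(-1,1)}$, $Y_{(1,0)}$ and $Y_{(0,1)}$. -/

import Mathlib

noncomputable section

namespace SBarTwo

open MvPolynomial

/-- The polynomial algebra `A₂ = ℂ[t₁, t₂]`; the variable `t₁` is `X 0`, the variable `t₂` is
`X 1`. -/
abbrev A2 : Type := MvPolynomial (Fin 2) ℂ

/-- The Witt algebra `W₂` of derivations of `A₂`. -/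
abbrev W2 : Type := Derivation ℂ A2 A2

/-- The divergence of `p₁ ∂₁ + p₂ ∂₂`, namely `∂₁ p₁ + ∂₂ p₂`; here `pᵢ = D tᵢ`. -/
def divergence (D : W2) : A2 := ∑ i : Fin 2, pderiv i (D (X i))

theorem derivation_apply (D : W2) (f : A2) :
    D f = D (X 0) * pderiv 0 f + D (X 1) * pderiv 1 f := by
  have h : D = D (X 0) • (pderiv 0 : W2) + D (X 1) • (pderiv 1 : W2) := by
    apply MvPolynomial.derivation_ext
    intro i
    fin_cases i <;> simp [pderiv_X]
  conv_lhs => rw [h]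
  simp

theorem pderiv_comm (i j : Fin 2) (f : A2) :
    pderiv i (pderiv j f) = pderiv j (pderiv i f) := by
  have h : ⁅(pderiv i : W2), (pderiv j : W2)⁆ = 0 := by
    apply MvPolynomial.derivation_ext
    intro k
    rw [Derivation.commutator_apply]
    simp only [pderiv_X, Pi.single_apply]
    split_ifs <;> simp
  have h' := congrArg (fun D : W2 => D f) h
  simp only [Derivation.commutator_apply, Derivation.zero_apply] at h'
  exact sub_eq_zero.mp h'

theorem divergence_lie (D E : W2) :
    divergence ⁅D, E⁆ = D (divergence E) - E (divergence D) := by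
  simp only [divergence, Fin.sum_univ_two, Derivation.commutator_apply]
  rw [derivation_apply D (E (X 0)), derivation_apply D (E (X 1)),
    derivation_apply E (D (X 0)), derivation_apply E (D (X 1)),
    derivation_apply D (_ + _), derivation_apply E (_ + _)]
  simp only [map_add, map_sub, Derivation.leibniz, smul_eq_mul]
  rw [pderiv_comm 1 0 (E (X 0)), pderiv_comm 1 0 (D (X 0)),
    pderiv_comm 1 0 (E (X 1)), pderiv_comm 1 0 (D (X 1))]
  ring

/-- The Lie algebra `S̄₂` of all derivations of `A₂` whose divergence is constant. -/
def SBar : LieSubalgebra ℂ W2 where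
  carrier := {D | ∃ c : ℂ, divergence D = C c}
  add_mem' := by
    rintro D E ⟨c, hc⟩ ⟨e, he⟩
    refine ⟨c + e, ?_⟩
    rw [map_add, ← hc, ← he]
    simp only [divergence, Derivation.add_apply, map_add, Finset.sum_add_distrib]
  zero_mem' := ⟨0, by simp [divergence]⟩
  smul_mem' := by
    rintro a D ⟨c, hc⟩
    refine ⟨a * c, ?_⟩
    rw [map_mul, ← hc]
    simp [divergence, MvPolynomial.smul_eq_C_mul, mul_add]
  lie_mem' := by
    rintro D E ⟨c, hc⟩ ⟨e, he⟩
    have hc' : divergence D = C c := hc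
    have he' : divergence E = C e := he
    refine ⟨0, ?_⟩
    rw [divergence_lie, hc', he', MvPolynomial.derivation_C, MvPolynomial.derivation_C]
    simp

/-- `∂ᵢ` as an element of `S̄₂`. -/
def partialS (i : Fin 2) : SBar :=
  ⟨pderiv i, 0, by
    simp only [divergence, pderiv_X, Pi.single_apply, Fin.sum_univ_two]
    split_ifs <;> simp⟩

/-- `dᵢ = tᵢ ∂ᵢ` as an element of `S̄₂`. -/
def eulerS (i : Fin 2) : SBar :=
  ⟨(X i : A2) • (pderiv i : W2), 1, by
    fin_cases i <;> simp [divergence, pderiv_X]⟩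

/-- The derivation `(1 + α₂) t^{α + e₁} ∂₁ - (1 + α₁) t^{α + e₂} ∂₂`, meant for `α₁, α₂ ≥ -1`. For
such `α` an exponent can only be negative where the coefficient in front of it vanishes. -/
def derivationL (α : ℤ × ℤ) : W2 :=
  ((1 + α.2 : ℤ) : ℂ) • ((X 0 ^ (α.1 + 1).toNat * X 1 ^ α.2.toNat : A2) • (pderiv 0 : W2)) -
    ((1 + α.1 : ℤ) : ℂ) • ((X 0 ^ α.1.toNat * X 1 ^ (α.2 + 1).toNat : A2) • (pderiv 1 : W2))

theorem derivationL_mem (α : ℤ × ℤ) (h : -1 ≤ α.1 ∧ -1 ≤ α.2) : derivationL α ∈ SBar := by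
  obtain ⟨a, b⟩ := α
  obtain ⟨h1, h2⟩ := h
  simp only at h1 h2
  obtain ⟨m, rfl⟩ : ∃ m : ℕ, a = (m : ℤ) - 1 := ⟨(a + 1).toNat, by omega⟩
  obtain ⟨n, rfl⟩ : ∃ n : ℕ, b = (n : ℤ) - 1 := ⟨(b + 1).toNat, by omega⟩
  refine ⟨0, ?_⟩
  have e2 : ∀ k : ℕ, ((k : ℤ) - 1).toNat = k - 1 := fun k => by omega
  simp [divergence, derivationL, pderiv_X, e2, MvPolynomial.smul_eq_C_mul]
  ring

/-- The element `L_α` of `S̄₂`, for `α ∈ ℤ²` with `α₁, α₂ ≥ -1` (and `0` for other `α`, which are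
never used). -/
def genL (α : ℤ × ℤ) : SBar :=
  if h : -1 ≤ α.1 ∧ -1 ≤ α.2 then ⟨derivationL α, derivationL_mem α h⟩ else 0

/-- The universal enveloping algebra `U(S̄₂)`. -/
abbrev U : Type := UniversalEnvelopingAlgebra ℂ SBar

/-- The canonical map `S̄₂ → U(S̄₂)`. -/
def toU (x : SBar) : U := UniversalEnvelopingAlgebra.ι ℂ x

theorem toU_lie (x y : SBar) : toU ⁅x, y⁆ = toU x * toU y - toU y * toU x := by
  let _ : LieRing U := LieRing.ofAssociativeRing
  exact (UniversalEnvelopingAlgebra.ι ℂ).map_lie x y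

theorem toU_partial_comm (i j : Fin 2) :
    toU (partialS i) * toU (partialS j) = toU (partialS j) * toU (partialS i) := by
  have h : ⁅partialS i, partialS j⁆ = 0 := by
    apply Subtype.ext
    apply Derivation.ext
    intro f
    change ⁅(pderiv i : W2), (pderiv j : W2)⁆ f = 0
    rw [Derivation.commutator_apply, pderiv_comm, sub_self]
  have h' := toU_lie (partialS i) (partialS j)
  rw [h] at h'
  have h0 : toU 0 = 0 := map_zero (UniversalEnvelopingAlgebra.ι ℂ)
  rw [h0] at h'
  exact sub_eq_zero.mp h'.symm

/-- The multiplicative set of all `∂₁^i ∂₂^j` in `U(S̄₂)`. -/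
def partialMonoid : Submonoid U where
  carrier := {u | ∃ i j : ℕ, u = toU (partialS 0) ^ i * toU (partialS 1) ^ j}
  one_mem' := ⟨0, 0, by simp⟩
  mul_mem' := by
    rintro _ _ ⟨i, j, rfl⟩ ⟨k, l, rfl⟩
    refine ⟨i + k, j + l, ?_⟩
    have h : Commute (toU (partialS 1) ^ j) (toU (partialS 0) ^ k) :=
      Commute.pow_pow (toU_partial_comm 1 0) j k
    rw [pow_add, pow_add, mul_assoc, ← mul_assoc (toU (partialS 1) ^ j), h.eq]
    simp only [mul_assoc]

/-! ### The Ore condition -/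

theorem leibniz_nilpotent_mul {R : Type*} [Ring R] (δ : R → R) (h0 : δ 0 = 0)
    (hadd : ∀ a b, δ (a + b) = δ a + δ b) (hmul : ∀ a b, δ (a * b) = δ a * b + a * δ b) :
    ∀ (N n m : ℕ) (a b : R), n + m = N → δ^[n] a = 0 → δ^[m] b = 0 → δ^[N] (a * b) = 0 := by
  have hz : ∀ k, δ^[k] 0 = 0 := fun k => Function.iterate_fixed h0 k
  have ha : ∀ k a b, δ^[k] (a + b) = δ^[k] a + δ^[k] b := by
    intro k
    induction k with
    | zero => simp
    | succ k ih => intro a b; simp only [Function.iterate_succ_apply, hadd, ih]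
  intro N
  induction N with
  | zero =>
    intro n m a b h h1 h2
    obtain ⟨rfl, rfl⟩ : n = 0 ∧ m = 0 := by omega
    simp only [Function.iterate_zero, id_eq] at h1
    simp [h1]
  | succ N ih =>
    intro n m a b h h1 h2
    rcases n with _ | n
    · simp only [Function.iterate_zero, id_eq] at h1
      rw [h1, zero_mul, hz]
    rcases m with _ | m
    · simp only [Function.iterate_zero, id_eq] at h2
      rw [h2, mul_zero, hz]
    rw [Function.iterate_succ_apply, hmul, ha,
      ih n (m + 1) (δ a) b (by omega) (by simpa using h1) h2,
      ih (n + 1) m a (δ b) (by omega) h1 (by simpa using h2), add_zero]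

theorem leibniz_nilpotent_add {R : Type*} [AddMonoid R] (δ : R → R) (h0 : δ 0 = 0)
    (hadd : ∀ a b, δ (a + b) = δ a + δ b) (n m : ℕ) (a b : R)
    (h1 : δ^[n] a = 0) (h2 : δ^[m] b = 0) : δ^[n + m] (a + b) = 0 := by
  have hz : ∀ k, δ^[k] 0 = 0 := fun k => Function.iterate_fixed h0 k
  have ha : ∀ k a b, δ^[k] (a + b) = δ^[k] a + δ^[k] b := by
    intro k
    induction k with
    | zero => simp
    | succ k ih => intro a b; simp only [Function.iterate_succ_apply, hadd, ih]
  rw [ha]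
  nth_rewrite 1 [add_comm n m]
  rw [Function.iterate_add_apply, h1, hz, Function.iterate_add_apply, h2, hz, add_zero]

theorem pderiv_nilpotent (j : Fin 2) (f : A2) : ∃ n : ℕ, (fun g : A2 => pderiv j g)^[n] f = 0 := by
  induction f using MvPolynomial.induction_on with
  | C a => exact ⟨1, by simp⟩
  | add p q hp hq =>
    obtain ⟨n, hn⟩ := hp
    obtain ⟨m, hm⟩ := hq
    exact ⟨n + m, leibniz_nilpotent_add _ (by simp) (by simp) n m p q hn hm⟩
  | mul_X p i hp =>
    obtain ⟨n, hn⟩ := hp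
    refine ⟨n + 2, leibniz_nilpotent_mul _ (by simp) (by simp) ?_ _ n 2 p (X i) rfl hn ?_⟩
    · intro a b
      simp only [Derivation.leibniz, smul_eq_mul]
      ring
    · simp only [Function.iterate_succ, Function.iterate_zero, Function.comp_apply, id_eq, pderiv_X,
        Pi.single_apply]
      split_ifs <;> simp

theorem lie_partial_nilpotent (j : Fin 2) (D : SBar) :
    ∃ n : ℕ, (fun E : SBar => ⁅partialS j, E⁆)^[n] D = 0 := by
  have key : ∀ (n : ℕ) (D : SBar) (i : Fin 2),
      (((fun E : SBar => ⁅partialS j, E⁆)^[n] D : SBar) : W2) (X i) =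
        (fun g : A2 => pderiv j g)^[n] ((D : W2) (X i)) := by
    intro n
    induction n with
    | zero => intro D i; rfl
    | succ n ih =>
      intro D i
      rw [Function.iterate_succ_apply, Function.iterate_succ_apply, ih]
      congr 1
      change ⁅(pderiv j : W2), (D : W2)⁆ (X i) = _
      rw [Derivation.commutator_apply]
      simp only [pderiv_X, Pi.single_apply]
      split_ifs <;> simp
  obtain ⟨n, hn⟩ := pderiv_nilpotent j ((D : W2) (X 0))
  obtain ⟨m, hm⟩ := pderiv_nilpotent j ((D : W2) (X 1))
  have hz : ∀ k, (fun g : A2 => pderiv j g)^[k] 0 = 0 :=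
    fun k => Function.iterate_fixed (by simp) k
  refine ⟨n + m, ?_⟩
  apply Subtype.ext
  apply MvPolynomial.derivation_ext
  intro i
  rw [key]
  fin_cases i
  · change (fun g : A2 => pderiv j g)^[n + m] ((D : W2) (X 0)) = 0
    rw [add_comm, Function.iterate_add_apply, hn, hz]
  · change (fun g : A2 => pderiv j g)^[n + m] ((D : W2) (X 1)) = 0
    rw [Function.iterate_add_apply, hm, hz]

/-- The commutator with `∂ⱼ` is locally nilpotent on `U(S̄₂)`. -/
theorem commutator_nilpotent (j : Fin 2) (u : U) :
    ∃ n : ℕ, (fun v : U => toU (partialS j) * v - v * toU (partialS j))^[n] u = 0 := by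
  set x := toU (partialS j) with hx
  obtain ⟨w, rfl⟩ : ∃ w, UniversalEnvelopingAlgebra.mkAlgHom ℂ SBar w = u :=
    RingCon.mkₐ_surjective _ u
  induction w using TensorAlgebra.induction with
  | algebraMap r =>
    refine ⟨1, ?_⟩
    simp only [Function.iterate_one, AlgHom.commutes]
    rw [Algebra.commutes, sub_self]
  | ι D =>
    obtain ⟨n, hn⟩ := lie_partial_nilpotent j D
    have key : ∀ (n : ℕ) (D : SBar), (fun v : U => x * v - v * x)^[n] (toU D) =
        toU ((fun E : SBar => ⁅partialS j, E⁆)^[n] D) := by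
      intro n
      induction n with
      | zero => intro D; rfl
      | succ n ih =>
        intro D
        rw [Function.iterate_succ_apply, Function.iterate_succ_apply, ← ih, toU_lie]
    refine ⟨n, ?_⟩
    change (fun v : U => x * v - v * x)^[n] (toU D) = 0
    rw [key, hn]
    exact map_zero (UniversalEnvelopingAlgebra.ι ℂ)
  | mul a b ha hb =>
    obtain ⟨n, hn⟩ := ha
    obtain ⟨m, hm⟩ := hb
    refine ⟨n + m, ?_⟩
    rw [map_mul]
    exact leibniz_nilpotent_mul _ (by simp) (fun a b => by noncomm_ring)
      (fun a b => by noncomm_ring) _ n m _ _ rfl hn hm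
  | add a b ha hb =>
    obtain ⟨n, hn⟩ := ha
    obtain ⟨m, hm⟩ := hb
    refine ⟨n + m, ?_⟩
    rw [map_add]
    exact leibniz_nilpotent_add _ (by simp) (fun a b => by noncomm_ring) n m _ _ hn hm

theorem ore_step {R : Type*} [Ring R] (x : R) (n : ℕ) (r : R)
    (h : (fun v : R => x * v - v * x)^[n] r = 0) : ∃ r', x ^ n * r = r' * x := by
  induction n generalizing r with
  | zero => exact ⟨0, by simpa using h⟩
  | succ n ih =>
    obtain ⟨r', hr'⟩ := ih (x * r - r * x) (by simpa using h)
    refine ⟨x ^ n * r + r', ?_⟩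
    rw [add_mul, ← hr']
    noncomm_ring

theorem ore_cancel_step {R : Type*} [Ring R] (x : R) (n : ℕ) (r : R)
    (h : (fun v : R => x * v - v * x)^[n] r = 0) (h0 : r * x = 0) : x ^ n * r = 0 := by
  induction n generalizing r with
  | zero => simpa using h
  | succ n ih =>
    have := ih (x * r - r * x) (by simpa using h) (by
      rw [sub_mul, mul_assoc, h0]; simp)
    rw [h0, sub_zero] at this
    rw [pow_succ, mul_assoc, this]

theorem ore_pow {R : Type*} [Ring R] (x : R)
    (hx : ∀ r, ∃ n : ℕ, (fun v : R => x * v - v * x)^[n] r = 0) (i : ℕ) (r : R) :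
    ∃ (n : ℕ) (r' : R), x ^ n * r = r' * x ^ i := by
  induction i with
  | zero => exact ⟨0, r, by simp⟩
  | succ i ih =>
    obtain ⟨n, r', h⟩ := ih
    obtain ⟨m, hm⟩ := hx r'
    obtain ⟨r'', h'⟩ := ore_step x m r' hm
    refine ⟨m + n, r'', ?_⟩
    rw [pow_add, mul_assoc, h, ← mul_assoc, h', mul_assoc, ← pow_succ']

theorem ore_cancel_pow {R : Type*} [Ring R] (x : R)
    (hx : ∀ r, ∃ n : ℕ, (fun v : R => x * v - v * x)^[n] r = 0) (i : ℕ) (r : R)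
    (h : r * x ^ i = 0) : ∃ n : ℕ, x ^ n * r = 0 := by
  induction i generalizing r with
  | zero => exact ⟨0, by simpa using h⟩
  | succ i ih =>
    obtain ⟨n, hn⟩ := ih (r * x) (by rw [mul_assoc, ← pow_succ', h])
    obtain ⟨m, hm⟩ := hx (x ^ n * r)
    refine ⟨m + n, ?_⟩
    rw [pow_add, mul_assoc]
    exact ore_cancel_step x m _ hm (by rw [mul_assoc, hn])

/-- The monomials in `∂₁, ∂₂` form an Ore set in `U(S̄₂)`. -/
theorem nonempty_oreSet : Nonempty (OreLocalization.OreSet partialMonoid) := by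
  have hc := toU_partial_comm 0 1
  rw [OreLocalization.nonempty_oreSet_iff]
  constructor
  · rintro r₁ r₂ ⟨_, i, j, rfl⟩ h
    have h' : ((r₁ - r₂) * toU (partialS 0) ^ i) * toU (partialS 1) ^ j = 0 := by
      rw [mul_assoc, sub_mul]
      exact sub_eq_zero.mpr h
    obtain ⟨n, hn⟩ := ore_cancel_pow _ (commutator_nilpotent 1) j _ h'
    rw [← mul_assoc] at hn
    obtain ⟨m, hm⟩ := ore_cancel_pow _ (commutator_nilpotent 0) i _ hn
    refine ⟨⟨_, m, n, rfl⟩, ?_⟩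
    rw [← mul_assoc, mul_sub] at hm
    exact sub_eq_zero.mp hm
  · rintro r ⟨_, i, j, rfl⟩
    obtain ⟨n, r', h⟩ := ore_pow _ (commutator_nilpotent 1) j r
    obtain ⟨m, r'', h'⟩ := ore_pow _ (commutator_nilpotent 0) i r'
    refine ⟨r'', ⟨_, m, n, rfl⟩, ?_⟩
    change toU (partialS 0) ^ m * toU (partialS 1) ^ n * r =
      r'' * (toU (partialS 0) ^ i * toU (partialS 1) ^ j)
    rw [mul_assoc, h, ← mul_assoc, h', mul_assoc]

instance oreSet : OreLocalization.OreSet partialMonoid := Classical.choice nonempty_oreSet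

/-- The localization `U₍₋₁₎` of `U(S̄₂)` at the Ore set of monomials in `∂₁, ∂₂`. -/
abbrev ULoc : Type := OreLocalization partialMonoid U

/-- The image of an element of `S̄₂` in `U₍₋₁₎`. -/
def toULoc (x : SBar) : ULoc := OreLocalization.numeratorHom (toU x)

/-- `∂ᵢ` as an invertible element of `U₍₋₁₎`. -/
def partialUnit (i : Fin 2) : ULocˣ :=
  OreLocalization.numeratorUnit
    (⟨toU (partialS i), by
      fin_cases i
      · exact ⟨1, 0, by simp⟩
      · exact ⟨0, 1, by simp⟩⟩ : partialMonoid)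

/-- `∂^β = ∂₁^{β₁} ∂₂^{β₂}` in `U₍₋₁₎`, for `β ∈ ℤ²`. -/
def partialPow (β : ℤ × ℤ) : ULoc :=
  ((partialUnit 0 ^ β.1 * partialUnit 1 ^ β.2 : ULocˣ) : ULoc)

/-- `dᵢ` in `U₍₋₁₎`. -/
def dLoc (i : Fin 2) : ULoc := toULoc (eulerS i)

/-- The subalgebra `H` of all `u ∈ U₍₋₁₎` that commute with `∂₁, ∂₂, d₁, d₂`. -/
def H : Subalgebra ℂ ULoc :=
  Subalgebra.centralizer ℂ
    {toULoc (partialS 0), toULoc (partialS 1), dLoc 0, dLoc 1}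

/-- The product `∏_{k = lo}^{hi} (x - k)` over integers `k`, equal to `1` when `hi < lo`. -/
def shiftProd (x : ULoc) (lo hi : ℤ) : ULoc :=
  ((List.range (hi + 1 - lo).toNat).map fun k : ℕ => x - ((lo + (k : ℤ) : ℤ) : ULoc)).prod

/-- The binomial coefficient `binom(α + 𝟏, β + 𝟏)` for `α, β ∈ ℤ²` with entries at least `-1`. -/
def binom (α β : ℤ × ℤ) : ℕ :=
  Nat.choose (α.1 + 1).toNat (β.1 + 1).toNat * Nat.choose (α.2 + 1).toNat (β.2 + 1).toNat

/-- The finite set of all `β ∈ ℤ²` with `β₁, β₂ ≥ -1`, `0 ≤ |β| < |α|` and `β ≠ 0`; the first three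
conditions force `β₁, β₂ ≤ |α|`. -/
def lowerSet (α : ℤ × ℤ) : Finset (ℤ × ℤ) :=
  (Finset.Icc (-1) (α.1 + α.2) ×ˢ Finset.Icc (-1) (α.1 + α.2)).filter
    fun β => 0 ≤ β.1 + β.2 ∧ β.1 + β.2 < α.1 + α.2 ∧ β ≠ 0

theorem mem_lowerSet (α β : ℤ × ℤ) :
    β ∈ lowerSet α ↔ -1 ≤ β.1 ∧ -1 ≤ β.2 ∧ 0 ≤ β.1 + β.2 ∧ β.1 + β.2 < α.1 + α.2 ∧ β ≠ 0 := by
  simp only [lowerSet, Finset.mem_filter, Finset.mem_product, Finset.mem_Icc]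
  constructor
  · rintro ⟨⟨⟨h1, _⟩, h2, _⟩, h3, h4, h5⟩
    exact ⟨h1, h2, h3, h4, h5⟩
  · rintro ⟨h1, h2, h3, h4, h5⟩
    exact ⟨⟨⟨h1, by omega⟩, h2, by omega⟩, h3, h4, h5⟩

/-- The element `Y_α` of `U₍₋₁₎`, for `α ∈ ℤ²` with `α₁, α₂ ≥ -1`, `|α| ≥ 0` and `α ≠ 0`. -/
def Y (α : ℤ × ℤ) : ULoc :=
  toULoc (genL α) * partialPow α +
  ∑ β ∈ lowerSet α,
    ((-1 : ℂ) ^ ((α.1 + α.2) - (β.1 + β.2)) * (binom α β : ℂ)) •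
      (toULoc (genL β) * shiftProd (dLoc 0) 0 (α.1 - β.1 - 1) *
        shiftProd (dLoc 1) 0 (α.2 - β.2 - 1) * partialPow β) +
  ((-1 : ℂ) ^ (α.1 + α.2) * ((α.1 * (α.2 + 1) : ℤ) : ℂ)) •
    (shiftProd (dLoc 0) (-1) (α.1 - 1) * shiftProd (dLoc 1) 0 (α.2 - 1)) +
  ((-1 : ℂ) ^ (α.1 + α.2 - 1) * (((α.1 + 1) * α.2 : ℤ) : ℂ)) •
    (shiftProd (dLoc 0) 0 (α.1 - 1) * shiftProd (dLoc 1) (-1) (α.2 - 1))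

/-- The indices of the elements `Y_α`: all `α ∈ ℤ²` with `α₁, α₂ ≥ -1`, `|α| ≥ 0` and `α ≠ 0`. As a
definition of its own it carries no order inherited from `ℤ × ℤ`. -/
def YIndex : Type := {α : ℤ × ℤ // -1 ≤ α.1 ∧ -1 ≤ α.2 ∧ 0 ≤ α.1 + α.2 ∧ α ≠ 0}

/-- The ordered monomial `Y_{α₁} Y_{α₂} ⋯ Y_{αₖ}`, where `α₁ ≤ α₂ ≤ ⋯ ≤ αₖ` are the members of the
multiset `s`; it is `1` for the empty multiset. -/
def orderedMonomial [LinearOrder YIndex] (s : Multiset YIndex) : ULoc :=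
  (s.sort.map fun α => Y α.1).prod

end SBarTwo

end

/-! Let C be the subalgebra generated by ∂₁^{±1}, ∂₂^{±1}, d₁, d₂; then H is the centralizer of C.
The argument compares U₍₋₁₎ with H · C and recovers H from that product.

Up to the closed terms at its end, Y_α is a double alternating binomial transform of the L_β, one
transform per variable, with coefficients in C. The closed terms are the contribution of β = 0, (-1,
0), (0, -1), where L_β is d₁ - d₂, ∂₁, -∂₂ (`yTerm_boundary`, `Y_eq`). The transform turns the rule
[∂, L_j] = j L_{j-1} into a telescoping sum that vanishes, and all its terms have weight zero, so
Y_α lies in H (`commute_transform_unit`, `commute_transform_lie`).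

The coefficient of L_α in Y_α is the unit ∂^α. Hence the L_α can be solved for in terms of the Y_β
and C, and words in the Y_α times C span U₍₋₁₎. For the filtration by degree |α| + 1, commutators of
the Y_α drop the degree by one (`Y_commutator_mem_F`), so sorted words suffice. Finally, if V ⊆ H is
a subspace, an element of V · C that commutes with C already lies in V (`mem_of_mem_mul_C`): C
behaves like a Weyl algebra with trivial centre. Taking for V the span of the sorted words shows
that they span H.

For independence, the leading term of a word in the Y_α is the same word in the L_α times a monomial
in ∂₁, ∂₂. This reduces the claim to the independence of the ordered monomials in L_α, d_i,
∂_i^{±1}. Clearing denominators moves that to U(S̄₂), where it is half of the Poincaré-Birkhoff-Witt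
theorem. It is proved here from the faithful action on polynomials, through the map x ↦ x ⊗ 1 + 1 ⊗
ρ(x) and iterated convolutions of dual linear forms (`linearIndependent_wordProd`).

For generation, let G be the subalgebra generated by the given elements. Then G · C is a subalgebra
that contains L_(1,-1), L_(-1,1), L_(0,1), and brackets with these reach every L_α. So G · C =
U₍₋₁₎, and `mem_of_mem_mul_C` with V = G gives G = H. -/

noncomputable section

open scoped TensorProduct

/-! ### Linear independence of monomials in an enveloping algebra -/

namespace UniversalEnvelopingAlgebra

attribute [local instance] LieRing.ofAssociativeRing

variable {K 𝔤 A I : Type*} [Field K] [LieRing 𝔤] [LieAlgebra K 𝔤] [Ring A] [Algebra K A]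

/-- The algebra map `U(𝔤) → U(𝔤) ⊗ A` with `x ↦ x ⊗ 1 + 1 ⊗ ρ x`. -/
def coaction (ρ : 𝔤 →ₗ⁅K⁆ A) :
    UniversalEnvelopingAlgebra K 𝔤 →ₐ[K] UniversalEnvelopingAlgebra K 𝔤 ⊗[K] A :=
  lift K
    { toFun := fun x => ι K x ⊗ₜ[K] (1 : A) + 1 ⊗ₜ[K] ρ x
      map_add' := fun x y => by
        simp only [map_add, TensorProduct.add_tmul, TensorProduct.tmul_add]
        abel
      map_smul' := fun c x => by
        simp only [map_smul, TensorProduct.smul_tmul', TensorProduct.tmul_smul, RingHom.id_apply,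
          smul_add]
      map_lie' := fun {x y} => by
        simp only [LieHom.map_lie, Ring.lie_def, add_mul, mul_add,
          Algebra.TensorProduct.tmul_mul_tmul, one_mul, mul_one, TensorProduct.sub_tmul,
          TensorProduct.tmul_sub]
        abel }

theorem coaction_ι (ρ : 𝔤 →ₗ⁅K⁆ A) (x : 𝔤) :
    coaction ρ (ι K x) = ι K x ⊗ₜ[K] (1 : A) + 1 ⊗ₜ[K] ρ x :=
  lift_ι_apply K _ x

/-- The product in `U(𝔤)` of the elements `x i` along a word. -/
def wordProd (x : I → 𝔤) (l : List I) : UniversalEnvelopingAlgebra K 𝔤 :=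
  (l.map fun i => ι K (x i)).prod

/-- The linear form `ψ ⊗ φ` on `U(𝔤) ⊗ A`. -/
def tensorForm (ψ : UniversalEnvelopingAlgebra K 𝔤 →ₗ[K] K) (φ : A →ₗ[K] K) :
    UniversalEnvelopingAlgebra K 𝔤 ⊗[K] A →ₗ[K] K :=
  LinearMap.mul' K K ∘ₗ TensorProduct.map ψ φ

theorem tensorForm_tmul (ψ : UniversalEnvelopingAlgebra K 𝔤 →ₗ[K] K) (φ : A →ₗ[K] K)
    (u : UniversalEnvelopingAlgebra K 𝔤) (a : A) : tensorForm ψ φ (u ⊗ₜ a) = ψ u * φ a := by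
  simp [tensorForm]

/-- The iterated convolution of the linear forms `φ i` along a word. -/
def convForm (ρ : 𝔤 →ₗ⁅K⁆ A) (φ : I → A →ₗ[K] K) :
    List I → UniversalEnvelopingAlgebra K 𝔤 →ₗ[K] K
  | [] => (lift K (0 : 𝔤 →ₗ⁅K⁆ K)).toLinearMap
  | i :: l => tensorForm (convForm ρ φ l) (φ i) ∘ₗ (coaction ρ).toLinearMap

section Form

variable (ρ : 𝔤 →ₗ⁅K⁆ A) (x : I → 𝔤) (ψ : UniversalEnvelopingAlgebra K 𝔤 →ₗ[K] K) (φ : A →ₗ[K] K)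

/-- `coaction` is multiplicative, so each letter goes either to the left tensor factor or, through
ρ, to the right one. Here `p` and `a` record where the earlier letters have gone. -/
theorem tensorForm_cons (p m : List I) (i : I) (a : A) :
    tensorForm ψ φ (wordProd x p ⊗ₜ a * coaction ρ (wordProd x (i :: m))) =
      tensorForm ψ φ (wordProd x (p ++ [i]) ⊗ₜ a * coaction ρ (wordProd x m)) +
      tensorForm ψ φ (wordProd x p ⊗ₜ (a * ρ (x i)) * coaction ρ (wordProd x m)) := by
  have h : coaction ρ (wordProd x (i :: m)) =
      (ι K (x i) ⊗ₜ[K] (1 : A) + 1 ⊗ₜ[K] ρ (x i)) * coaction ρ (wordProd x m) := by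
    simp only [wordProd, List.map_cons, List.prod_cons, map_mul, coaction_ι]
  rw [h, ← mul_assoc, mul_add, add_mul, map_add, Algebra.TensorProduct.tmul_mul_tmul,
    Algebra.TensorProduct.tmul_mul_tmul, mul_one, mul_one]
  simp [wordProd]

theorem tensorForm_nil (p : List I) (a : A) :
    tensorForm ψ φ (wordProd x p ⊗ₜ a * coaction ρ (wordProd x ([] : List I))) =
      ψ (wordProd x p) * φ a := by
  simp [wordProd, tensorForm_tmul]

variable {k : ℕ} (hψ : ∀ m : List I, m.length < k → ψ (wordProd x m) = 0)
include hψ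

/-- Each term of the expansion has on the left a subword of `p ++ m`, which is too short for `ψ`. -/
theorem tensorForm_eq_zero (m : List I) : ∀ (p : List I) (a : A), p.length + m.length < k →
    tensorForm ψ φ (wordProd x p ⊗ₜ a * coaction ρ (wordProd x m)) = 0 := by
  induction m with
  | nil =>
    intro p a h
    rw [tensorForm_nil, hψ p (by simpa using h), zero_mul]
  | cons i m ih =>
    intro p a h
    simp only [List.length_cons] at h
    rw [tensorForm_cons, ih _ _ (by simp; omega), ih _ _ (by omega), add_zero]

/-- Sending any letter of `m` to the right shortens the left word below `k`, so only the term with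
all letters on the left survives. -/
theorem tensorForm_eq_mul (m : List I) : ∀ (p : List I) (a : A), p.length + m.length = k →
    tensorForm ψ φ (wordProd x p ⊗ₜ a * coaction ρ (wordProd x m)) =
      ψ (wordProd x (p ++ m)) * φ a := by
  induction m with
  | nil => intro p a h; rw [tensorForm_nil, List.append_nil]
  | cons i m ih =>
    intro p a h
    simp only [List.length_cons] at h
    rw [tensorForm_cons, ih _ _ (by simp; omega), tensorForm_eq_zero ρ x ψ φ hψ m _ _ (by omega),
      add_zero]
    simp

end Form

theorem convForm_apply (ρ : 𝔤 →ₗ⁅K⁆ A) (x : I → 𝔤) (φ : I → A →ₗ[K] K) (i : I) (l m : List I) :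
    convForm ρ φ (i :: l) (wordProd x m) = tensorForm (convForm ρ φ l) (φ i)
      (wordProd x ([] : List I) ⊗ₜ (1 : A) * coaction ρ (wordProd x m)) := by
  have : (wordProd x ([] : List I) : UniversalEnvelopingAlgebra K 𝔤) ⊗ₜ[K] (1 : A) = 1 := rfl
  rw [this, one_mul]
  rfl

variable (ρ : 𝔤 →ₗ⁅K⁆ A) (x : I → 𝔤) (φ : I → A →ₗ[K] K) (hφ1 : ∀ i, φ i 1 = 0)

-- Each letter of `l` must absorb at least one letter of `m`, since its form kills `1`; a shorter
-- word has too few letters.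
include hφ1 in
theorem convForm_eq_zero (l : List I) :
    ∀ m : List I, m.length < l.length → convForm ρ φ l (wordProd x m) = 0 := by
  induction l with
  | nil => intro m h; simp at h
  | cons i l ih =>
    intro m h
    rw [convForm_apply]
    simp only [List.length_cons] at h
    rcases Nat.lt_or_ge m.length l.length with h' | h'
    · exact tensorForm_eq_zero ρ x _ _ ih m _ _ (by simpa using h')
    · rw [tensorForm_eq_mul ρ x _ _ ih m _ _ (by simp; omega), hφ1, mul_zero]

variable [DecidableEq I] (hφ : ∀ i j, φ i (ρ (x j)) = if i = j then 1 else 0)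
include hφ1 hφ

/-- On words of equal length every form absorbs exactly one letter, and duality forces that letter
to match. The value counts such matchings; in characteristic zero only the positivity of this count
matters. -/
theorem convForm_eq_natCast (l : List I) : ∀ m : List I, m.length = l.length →
    ∃ N : ℕ, convForm ρ φ l (wordProd x m) = N ∧ (m.Perm l → 0 < N) ∧ (¬ m.Perm l → N = 0) := by
  induction l with
  | nil =>
    intro m h
    obtain rfl : m = [] := by simpa using h
    refine ⟨1, by simp [convForm, wordProd], by simp, by simp⟩
  | cons i l ih =>
    -- Induction on the letters `m` still to be distributed, those of `p` having gone left. The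
    -- condition `i ∈ m` says that a letter `i` is still available for the right factor.
    have key : ∀ m p : List I, p.length + m.length = l.length + 1 →
        ∃ N : ℕ, tensorForm (convForm ρ φ l) (φ i)
            (wordProd x p ⊗ₜ (1 : A) * coaction ρ (wordProd x m)) = N ∧
          ((p ++ m).Perm (i :: l) → i ∈ m → 0 < N) ∧ (¬ (p ++ m).Perm (i :: l) → N = 0) := by
      intro m
      induction m with
      | nil =>
        intro p h
        refine ⟨0, ?_, by simp, by simp⟩
        rw [tensorForm_nil, hφ1]
        simp
      | cons j m ihm =>
        intro p h
        simp only [List.length_cons] at h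
        obtain ⟨N, hN, hN1, hN2⟩ := ihm (p ++ [j]) (by simp; omega)
        obtain ⟨M, hM, hM1, hM2⟩ := ih (p ++ m) (by simp; omega)
        have hperm : (p ++ j :: m).Perm (j :: (p ++ m)) := List.perm_middle
        simp only [List.append_assoc, List.singleton_append] at hN1 hN2
        by_cases hij : i = j
        · subst hij
          have hiff : (p ++ i :: m).Perm (i :: l) ↔ (p ++ m).Perm l :=
            ⟨fun h => (List.perm_cons i).1 (hperm.symm.trans h),
              fun h => hperm.trans ((List.perm_cons i).2 h)⟩
          refine ⟨N + M, ?_, ?_, ?_⟩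
          · rw [tensorForm_cons, hN, one_mul,
              tensorForm_eq_mul ρ x _ _ (convForm_eq_zero ρ x φ hφ1 l) m _ _ (by omega), hM, hφ]
            simp
          · intro h1 _
            have := hM1 (hiff.1 h1)
            omega
          · intro h1
            rw [hN2 h1, hM2 (fun h2 => h1 (hiff.2 h2))]
        · refine ⟨N, ?_, ?_, hN2⟩
          · rw [tensorForm_cons, hN, one_mul,
              tensorForm_eq_mul ρ x _ _ (convForm_eq_zero ρ x φ hφ1 l) m _ _ (by omega), hM, hφ]
            simp [hij]
          · intro h1 h2
            exact hN1 h1 (by simpa [hij] using h2)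
    intro m h
    obtain ⟨N, hN, hN1, hN2⟩ := key m [] (by simpa using h)
    refine ⟨N, by rw [convForm_apply, hN], fun hp => hN1 hp ?_, fun hp => hN2 hp⟩
    exact hp.mem_iff.2 (by simp)

/-- Words with pairwise distinct contents are linearly independent in `U(𝔤)`, as soon as the letters
together with `1` are separated by linear forms in some associative representation. -/
theorem linearIndependent_wordProd [CharZero K] {J : Type*} (w : J → List I)
    (hw : ∀ i j, (w i).Perm (w j) → i = j) :
    LinearIndependent K fun j => (wordProd x (w j) : UniversalEnvelopingAlgebra K 𝔤) := by
  rw [linearIndependent_iff]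
  intro g hg
  by_contra hne
  -- For a longest word in the relation, its convolution form kills the shorter words and the words
  -- of equal length with other contents, which isolates `g j₀`.
  obtain ⟨j₀, hj₀, hmax⟩ := g.support.exists_max_image (fun j => (w j).length)
    (Finsupp.support_nonempty_iff.2 hne)
  have h := congrArg (convForm ρ φ (w j₀)) hg
  rw [Finsupp.linearCombination_apply, Finsupp.sum, map_sum, map_zero,
    Finset.sum_eq_single_of_mem j₀ hj₀] at h
  · obtain ⟨N, hN, hN1, -⟩ := convForm_eq_natCast ρ x φ hφ1 hφ (w j₀) (w j₀) rfl
    rw [map_smul, hN, smul_eq_mul, mul_eq_zero] at h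
    have := hN1 (List.Perm.refl _)
    rcases h with h | h
    · exact Finsupp.mem_support_iff.1 hj₀ h
    · rw [Nat.cast_eq_zero] at h
      omega
  · intro j hj hjne
    rw [map_smul]
    rcases (hmax j hj).lt_or_eq with hlt | heq
    · rw [convForm_eq_zero ρ x φ hφ1 _ _ hlt, smul_zero]
    · obtain ⟨N, hN, -, hN2⟩ := convForm_eq_natCast ρ x φ hφ1 hφ (w j₀) (w j) heq
      rw [hN, hN2 (fun hp => hjne (hw _ _ hp)), Nat.cast_zero, smul_zero]

end UniversalEnvelopingAlgebra

namespace SBarTwo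

/-! ### A unit `p` and an element `d` with `[p, d] = p` -/

section WeylPair

variable {R : Type*} [Ring R]

/-- The falling factorial `d (d - 1) ⋯ (d - n + 1)`. -/
def falling (d : R) : ℕ → R
  | 0 => 1
  | n + 1 => falling d n * (d - n)

theorem commute_falling {x d : R} (h : Commute x d) (n : ℕ) : Commute x (falling d n) := by
  induction n with
  | zero => exact Commute.one_right x
  | succ n ih => exact ih.mul_right (h.sub_right (Nat.cast_commute n x).symm)

variable [Algebra ℂ R]

/-- Conjugation by `p` shifts `d` to `d + 1`, and the forward difference of the n-th falling
factorial is n times the previous one. -/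
theorem mul_falling {p d : R} (h : p * d = d * p + p) (n : ℕ) :
    p * falling d n = (falling d n + (n : ℂ) • falling d (n - 1)) * p := by
  induction n with
  | zero => simp [falling]
  | succ n ih =>
    have h1 : p * (d - n) = (d - n + 1) * p := by
      rw [mul_sub, h, (Nat.cast_commute n p).symm.eq, add_mul, sub_mul, one_mul]
      abel
    have h2 : (n : ℂ) • falling d (n - 1) * (d - n + 1) = (n : ℂ) • falling d n := by
      cases n with
      | zero => simp
      | succ k => simp [falling, sub_add_eq_sub_sub]
    simp only [falling, Nat.add_sub_cancel]
    rw [← mul_assoc, ih, mul_assoc, h1, ← mul_assoc, add_mul (falling d n), h2]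
    congr 1
    push_cast
    rw [mul_add, mul_one, add_smul, one_smul]
    abel

theorem zpow_mul_of_lie {p : Rˣ} {d : R} (h : (p : R) * d = d * p + p) (n : ℤ) :
    ((p ^ n : Rˣ) : R) * d = (d + (n : ℂ) • 1) * ((p ^ n : Rˣ) : R) := by
  have hinv : ((p⁻¹ : Rˣ) : R) * d = (d - 1) * ((p⁻¹ : Rˣ) : R) := by
    rw [Units.inv_mul_eq_iff_eq_mul, ← mul_assoc, Units.eq_mul_inv_iff_mul_eq, mul_sub, h, mul_one]
    abel
  induction n using Int.induction_on with
  | zero => simp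
  | succ n ih =>
    rw [zpow_add_one, Units.val_mul, mul_assoc, h, mul_add, ← mul_assoc, ih]
    push_cast
    simp only [add_smul, one_smul, add_mul, mul_assoc, smul_mul_assoc, one_mul]
    abel
  | pred n ih =>
    rw [zpow_sub_one, Units.val_mul, mul_assoc, hinv, ← mul_assoc, mul_sub, ih]
    push_cast
    simp only [sub_smul, one_smul, add_mul, mul_assoc, smul_mul_assoc, one_mul, mul_one, sub_mul]
    abel

/-- The span of all `d (d - 1) ⋯ (d - a + 1) p ^ n` with `a ∈ ℕ` and `n ∈ ℤ`. -/
def weylSpan (p : Rˣ) (d : R) : Submodule ℂ R :=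
  Submodule.span ℂ (Set.range fun x : ℕ × ℤ => falling d x.1 * ((p ^ x.2 : Rˣ) : R))

theorem falling_mul (d : R) (a : ℕ) :
    falling d a * d = falling d (a + 1) + (a : ℂ) • falling d a := by
  have : (a : R) = (a : ℂ) • (1 : R) := by rw [Nat.cast_smul_eq_nsmul, nsmul_one]
  rw [falling, mul_sub, this, mul_smul_comm, mul_one, sub_add_cancel]

theorem one_mem_weylSpan (p : Rˣ) (d : R) : 1 ∈ weylSpan p d :=
  Submodule.subset_span ⟨(0, 0), by simp [falling]⟩

theorem weylSpan_mul_zpow {p : Rˣ} {d : R} {u : R} (hu : u ∈ weylSpan p d) (n : ℤ) :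
    u * ((p ^ n : Rˣ) : R) ∈ weylSpan p d := by
  induction hu using Submodule.span_induction with
  | mem _ h =>
    obtain ⟨⟨a, m⟩, rfl⟩ := h
    refine Submodule.subset_span ⟨(a, m + n), ?_⟩
    simp only [zpow_add, Units.val_mul, mul_assoc]
  | zero => simp
  | add x y _ _ hx hy => rw [add_mul]; exact add_mem hx hy
  | smul c x _ hx => rw [smul_mul_assoc]; exact Submodule.smul_mem _ _ hx

theorem weylSpan_mul {p : Rˣ} {d : R} (h : (p : R) * d = d * p + p) {u : R}
    (hu : u ∈ weylSpan p d) : u * d ∈ weylSpan p d := by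
  induction hu using Submodule.span_induction with
  | mem _ hu =>
    obtain ⟨⟨a, m⟩, rfl⟩ := hu
    simp only
    rw [mul_assoc, zpow_mul_of_lie h, ← mul_assoc, mul_add, falling_mul, mul_smul_comm, mul_one,
      add_mul, add_mul, smul_mul_assoc, smul_mul_assoc]
    have key : ∀ b, falling d b * ((p ^ m : Rˣ) : R) ∈ weylSpan p d := fun b =>
      Submodule.subset_span ⟨(b, m), rfl⟩
    exact add_mem (add_mem (key _) (Submodule.smul_mem _ _ (key _)))
      (Submodule.smul_mem _ _ (key _))
  | zero => simp
  | add x y _ _ hx hy => rw [add_mul]; exact add_mem hx hy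
  | smul c x _ hx => rw [smul_mul_assoc]; exact Submodule.smul_mem _ _ hx

/-! #### Elements commuting with `p` and `d` -/

section Centralizer

variable {p : Rˣ} {d : R} {V : Submodule ℂ R} (h : (p : R) * d = d * p + p)
  (hVp : ∀ v ∈ V, Commute v (p : R)) (hVd : ∀ v ∈ V, Commute v d)

-- The elements v · (polynomial in d) · pⁿ are eigenvectors of [d, ·] with eigenvalue -n. So `w`
-- collects the terms with n = 0, and the rest is killed by a product of factors X + n with n ≠ 0.
include hVd h in
theorem exists_weight_zero_part {u : R} (hu : u ∈ V * weylSpan p d) :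
    ∃ w ∈ V * Submodule.span ℂ (Set.range (falling d)), ∃ P : Polynomial ℂ, P.eval 0 ≠ 0 ∧
      Polynomial.aeval (LinearMap.mulLeft ℂ d - LinearMap.mulRight ℂ d) P (u - w) = 0 := by
  have hadd : ∀ u v : R,
      (∃ w ∈ V * Submodule.span ℂ (Set.range (falling d)), ∃ P : Polynomial ℂ, P.eval 0 ≠ 0 ∧
        Polynomial.aeval (LinearMap.mulLeft ℂ d - LinearMap.mulRight ℂ d) P (u - w) = 0) →
      (∃ w ∈ V * Submodule.span ℂ (Set.range (falling d)), ∃ P : Polynomial ℂ, P.eval 0 ≠ 0 ∧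
        Polynomial.aeval (LinearMap.mulLeft ℂ d - LinearMap.mulRight ℂ d) P (v - w) = 0) →
      (∃ w ∈ V * Submodule.span ℂ (Set.range (falling d)), ∃ P : Polynomial ℂ, P.eval 0 ≠ 0 ∧
        Polynomial.aeval (LinearMap.mulLeft ℂ d - LinearMap.mulRight ℂ d) P (u + v - w) = 0) := by
    rintro u v ⟨w, hw, P, hP, h1⟩ ⟨w', hw', P', hP', h2⟩
    refine ⟨w + w', add_mem hw hw', P * P', by simp [hP, hP'], ?_⟩
    have e : u + v - (w + w') = (u - w) + (v - w') := by abel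
    rw [e, map_add, map_mul, Module.End.mul_apply, Module.End.mul_apply, h2, map_zero, add_zero,
      ← Module.End.mul_apply, ← map_mul, mul_comm, map_mul, Module.End.mul_apply, h1, map_zero]
  induction hu using Submodule.mul_induction_on' with
  | mem_mul_mem v hv c hc =>
    induction hc using Submodule.span_induction with
    | mem _ hc =>
      obtain ⟨⟨a, n⟩, rfl⟩ := hc
      by_cases hn : n = 0
      · subst hn
        refine ⟨v * falling d a, Submodule.mul_mem_mul hv (Submodule.subset_span ⟨a, rfl⟩), 1,
          by simp, by simp⟩
      · refine ⟨0, zero_mem _, Polynomial.X + Polynomial.C (n : ℂ), by simpa using hn, ?_⟩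
        have e : v * (falling d a * ((p ^ n : Rˣ) : R)) * d =
            d * (v * (falling d a * ((p ^ n : Rˣ) : R))) +
              (n : ℂ) • (v * (falling d a * ((p ^ n : Rˣ) : R))) := by
          have c : Commute (v * falling d a) d :=
            (hVd v hv).mul_left (commute_falling (Commute.refl d) a).symm
          rw [← mul_assoc v, mul_assoc, zpow_mul_of_lie h, ← mul_assoc, mul_add, c.eq,
            mul_smul_comm, mul_one, add_mul, smul_mul_assoc, mul_assoc d]
        simp only [sub_zero, map_add, Polynomial.aeval_X, Polynomial.aeval_C, LinearMap.add_apply,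
          LinearMap.sub_apply, LinearMap.mulLeft_apply, LinearMap.mulRight_apply, e,
          Module.algebraMap_end_apply]
        abel
    | zero => exact ⟨0, zero_mem _, 1, by simp, by simp⟩
    | add x y _ _ hx hy => rw [mul_add]; exact hadd _ _ hx hy
    | smul c x _ hx =>
      obtain ⟨w, hw, P, hP, h1⟩ := hx
      refine ⟨c • w, Submodule.smul_mem _ _ hw, P, hP, ?_⟩
      rw [mul_smul_comm, ← smul_sub, map_smul, h1, smul_zero]
  | add x _ y _ hx hy => exact hadd _ _ hx hy

theorem aeval_apply_of_apply_eq_zero {M : Type*} [AddCommGroup M] [Module ℂ M] (f : Module.End ℂ M)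
    (P : Polynomial ℂ) (x : M) (hx : f x = 0) : Polynomial.aeval f P x = P.eval 0 • x := by
  induction P using Polynomial.induction_on' with
  | add P Q hP hQ => simp [hP, hQ, add_smul]
  | monomial n a =>
    cases n with
    | zero => simp [Module.algebraMap_end_apply]
    | succ n => simp [Polynomial.aeval_monomial, pow_succ, hx]

-- Both `u` and `w` commute with `d`, so `P([d, ·])` acts on `u - w` as the nonzero scalar `P(0)`;
-- hence `u = w`.
include hVd h in
theorem mem_mul_span_falling {u : R} (hu : u ∈ V * weylSpan p d) (hud : Commute u d) :
    u ∈ V * Submodule.span ℂ (Set.range (falling d)) := by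
  obtain ⟨w, hw, P, hP, h1⟩ := exists_weight_zero_part h hVd hu
  have hwd : Commute w d := by
    clear h1
    induction hw using Submodule.mul_induction_on' with
    | mem_mul_mem v hv c hc =>
      refine (hVd v hv).mul_left ?_
      induction hc using Submodule.span_induction with
      | mem _ hc =>
        obtain ⟨a, rfl⟩ := hc
        exact (commute_falling (Commute.refl d) a).symm
      | zero => exact Commute.zero_left d
      | add x y _ _ hx hy => exact hx.add_left hy
      | smul c x _ hx => exact hx.smul_left c
    | add x _ y _ hx hy => exact hx.add_left hy
  rw [aeval_apply_of_apply_eq_zero, smul_eq_zero, or_iff_right hP, sub_eq_zero] at h1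
  · rwa [h1]
  · simp only [LinearMap.sub_apply, LinearMap.mulLeft_apply, LinearMap.mulRight_apply, mul_sub,
      sub_mul, hud.eq, hwd.eq, sub_self]

theorem exists_sum_falling {u : R} (hu : u ∈ V * Submodule.span ℂ (Set.range (falling d))) :
    ∃ (N : ℕ) (f : ℕ → R), (∀ a, f a ∈ V) ∧ u = ∑ a ∈ Finset.range N, f a * falling d a := by
  suffices h : ∃ f : ℕ →₀ V, u = f.sum fun a v => (v : R) * falling d a by
    obtain ⟨f, rfl⟩ := h
    refine ⟨f.support.sup id + 1, fun a => f a, fun a => (f a).2, ?_⟩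
    refine Finsupp.sum_of_support_subset _ ?_ _ (by simp)
    intro a ha
    exact Finset.mem_range.2 (Nat.lt_succ_of_le (Finset.le_sup (f := id) ha))
  have hadd : ∀ u v : R, (∃ f : ℕ →₀ V, u = f.sum fun a v => (v : R) * falling d a) →
      (∃ f : ℕ →₀ V, v = f.sum fun a v => (v : R) * falling d a) →
      ∃ f : ℕ →₀ V, u + v = f.sum fun a v => (v : R) * falling d a := by
    rintro u v ⟨f, rfl⟩ ⟨g, rfl⟩
    exact ⟨f + g, by rw [Finsupp.sum_add_index'] <;> simp [add_mul]⟩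
  induction hu using Submodule.mul_induction_on' with
  | mem_mul_mem v hv c hc =>
    induction hc using Submodule.span_induction with
    | mem _ hc =>
      obtain ⟨a, rfl⟩ := hc
      exact ⟨Finsupp.single a ⟨v, hv⟩, by rw [Finsupp.sum_single_index]; simp⟩
    | zero => exact ⟨0, by simp⟩
    | add x y _ _ hx hy => rw [mul_add]; exact hadd _ _ hx hy
    | smul c x _ hx =>
      obtain ⟨f, hf⟩ := hx
      refine ⟨c • f, ?_⟩
      rw [mul_smul_comm, hf, Finsupp.sum_smul_index' (by simp), Finsupp.smul_sum]
      simp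
  | add x _ y _ hx hy => exact hadd _ _ hx hy

include hVp h in
theorem mul_sum_falling (f : ℕ → R) (hf : ∀ a, f a ∈ V) (M : ℕ) :
    p * ∑ a ∈ Finset.range (M + 1), f a * falling d a =
      (∑ a ∈ Finset.range (M + 1), f a * falling d a +
        ∑ a ∈ Finset.range M, (((a + 1 : ℕ) : ℂ) • f (a + 1)) * falling d a) * p := by
  have e : ∀ a, (p : R) * (f a * falling d a) =
      (f a * falling d a + ((a : ℂ) • f a) * falling d (a - 1)) * p := fun a => by
    rw [← mul_assoc, ← (hVp _ (hf a)).eq, mul_assoc, mul_falling h, ← mul_assoc, mul_add,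
      mul_smul_comm, smul_mul_assoc]
  rw [Finset.mul_sum, Finset.sum_congr rfl fun a _ => e a, ← Finset.sum_mul,
    Finset.sum_add_distrib]
  congr 2
  rw [Finset.sum_range_succ']
  simp

-- Commuting `p` past the relation yields its finite difference, a relation with one term fewer. By
-- induction all coefficients but the constant one vanish, and the relation then kills that one too.
include hVp h in
theorem eq_zero_of_sum_falling (N : ℕ) : ∀ f : ℕ → R, (∀ a, f a ∈ V) →
    ∑ a ∈ Finset.range N, f a * falling d a = 0 → ∀ a < N, f a = 0 := by
  induction N with
  | zero => intro f _ _ a ha; omega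
  | succ N ih =>
    intro f hf hs
    have e := mul_sum_falling h hVp f hf N
    rw [hs, mul_zero, zero_add, eq_comm, Units.mul_left_eq_zero] at e
    have h1 := ih (fun a => ((a + 1 : ℕ) : ℂ) • f (a + 1))
      (fun a => Submodule.smul_mem _ _ (hf _)) e
    have h2 : ∀ a < N, f (a + 1) = 0 := fun a ha => by
      have := h1 a ha
      rwa [smul_eq_zero, or_iff_right (Nat.cast_ne_zero.2 a.succ_ne_zero)] at this
    intro a ha
    cases a with
    | succ a => exact h2 a (by omega)
    | zero =>
      rw [Finset.sum_range_succ', Finset.sum_eq_zero] at hs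
      · simpa [falling] using hs
      · intro a ha
        rw [h2 a (Finset.mem_range.1 ha), zero_mul]

include hVp hVd h in
/-- An element of `V ⬝ ⟨p, p⁻¹, d⟩` that commutes with `p` and `d` lies in `V`, when `V` does. -/
theorem mem_of_commute {u : R} (hu : u ∈ V * weylSpan p d) (hup : Commute u (p : R))
    (hud : Commute u d) : u ∈ V := by
  obtain ⟨N, f, hf, rfl⟩ := exists_sum_falling (mem_mul_span_falling h hVd hu hud)
  cases N with
  | zero => simp
  | succ N =>
    have e := mul_sum_falling h hVp f hf N
    -- Commuting with `p` means that the finite difference is zero, so only the term with falling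
    -- factorial `1` remains.
    rw [← hup.eq, Units.mul_left_inj, left_eq_add] at e
    have h1 := eq_zero_of_sum_falling h hVp N (fun a => ((a + 1 : ℕ) : ℂ) • f (a + 1))
      (fun a => Submodule.smul_mem _ _ (hf _)) e
    rw [Finset.sum_range_succ', Finset.sum_eq_zero]
    · simpa [falling] using hf 0
    · intro a ha
      have := h1 a (Finset.mem_range.1 ha)
      rw [smul_eq_zero, or_iff_right (Nat.cast_ne_zero.2 a.succ_ne_zero)] at this
      rw [this, zero_mul]

end Centralizer

/-! #### The alternating binomial transform -/

/-- The coefficient `(-1) ^ (m - j) (m choose j) d (d - 1) ⋯ (d - (m - j) + 1) p ^ (j - 1)`. -/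
def transformCoeff (p : Rˣ) (d : R) (m j : ℕ) : R :=
  ((-1 : ℂ) ^ (m - j) * (m.choose j : ℂ)) • (falling d (m - j) * ((p ^ ((j : ℤ) - 1) : Rˣ) : R))

/-- The transform
`∑ j ≤ m, (-1) ^ (m - j) (m choose j) ℓ j d (d - 1) ⋯ (d - (m - j) + 1) p ^ (j - 1)`
of a sequence `ℓ`. -/
def transform (p : Rˣ) (d : R) (ℓ : ℕ → R) (m : ℕ) : R :=
  ∑ j ∈ Finset.range (m + 1), ℓ j * transformCoeff p d m j

variable {p : Rˣ} {d : R} {ℓ : ℕ → R}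

theorem transformCoeff_self (m : ℕ) :
    transformCoeff p d m m = ((p ^ ((m : ℤ) - 1) : Rˣ) : R) := by
  simp [transformCoeff, falling]

theorem commute_transformCoeff {x : R} (hp : Commute x (p : R)) (hd : Commute x d) (m j : ℕ) :
    Commute x (transformCoeff p d m j) := by
  refine Commute.smul_right (Commute.mul_right (commute_falling hd _) ?_) _
  exact hp.units_zpow_right _

/-- Moving `p` past the j-th term lowers either `ℓ j` or the falling factorial. The two kinds of
correction terms cancel after a shift of index, by (j+1) C(m, j+1) = (m-j) C(m, j) and the
alternating sign. -/
theorem commute_transform_unit (h : (p : R) * d = d * p + p)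
    (hℓ : ∀ j, p * ℓ j = ℓ j * p + (j : ℂ) • ℓ (j - 1)) (m : ℕ) :
    Commute (p : R) (transform p d ℓ m) := by
  have e : ∀ j, p * (ℓ j * transformCoeff p d m j) = ℓ j * transformCoeff p d m j * p +
      (((-1 : ℂ) ^ (m - j) * (m.choose j : ℂ) * j) •
        (ℓ (j - 1) * falling d (m - j) * ((p ^ ((j : ℤ) - 1) : Rˣ) : R)) +
      ((-1 : ℂ) ^ (m - j) * (m.choose j : ℂ) * (m - j : ℕ)) •
        (ℓ j * falling d (m - j - 1) * ((p ^ (j : ℤ) : Rˣ) : R))) := by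
    intro j
    have c : (p : R) * ((p ^ ((j : ℤ) - 1) : Rˣ) : R) = ((p ^ (j : ℤ) : Rˣ) : R) := by
      rw [← Units.val_mul, mul_self_zpow, sub_add_cancel]
    have c' : ((p ^ ((j : ℤ) - 1) : Rˣ) : R) * p = ((p ^ (j : ℤ) : Rˣ) : R) := by
      rw [← Units.val_mul, mul_zpow_self, sub_add_cancel]
    rw [transformCoeff, mul_smul_comm, mul_smul_comm, smul_mul_assoc, ← mul_assoc, hℓ, add_mul,
      mul_assoc (ℓ j) (p : R), ← mul_assoc (p : R), mul_falling h, mul_assoc _ (p : R), c,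
      mul_assoc (ℓ j) (_ * _), mul_assoc (falling d (m - j)), c', add_mul, mul_add, smul_add,
      smul_add, smul_mul_assoc, smul_mul_assoc, mul_smul_comm, smul_smul, smul_smul, ← mul_assoc,
      ← mul_assoc, ← mul_assoc]
    abel
  -- The first correction sum loses j = 0 through its factor j, the second loses j = m through its
  -- factor m - j; what remains matches term by term with the first index shifted by one.
  rw [Commute, SemiconjBy, transform, Finset.mul_sum, Finset.sum_congr rfl fun j _ => e j,
    Finset.sum_add_distrib, ← Finset.sum_mul, Finset.sum_add_distrib,
    Finset.sum_range_succ' (fun j => ((-1 : ℂ) ^ (m - j) * (m.choose j : ℂ) * j) • _),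
    Finset.sum_range_succ (fun j => ((-1 : ℂ) ^ (m - j) * (m.choose j : ℂ) * (m - j : ℕ)) • _),
    ← sub_eq_zero]
  simp only [Nat.cast_zero, mul_zero, zero_smul, add_zero, Nat.sub_self, add_sub_cancel_left]
  rw [← Finset.sum_add_distrib]
  refine Finset.sum_eq_zero fun j hj => ?_
  have hj := Finset.mem_range.1 hj
  have e1 : ((j + 1 : ℕ) : ℤ) - 1 = j := by push_cast; ring
  have e2 : m - (j + 1) = m - j - 1 := by omega
  rw [e1, Nat.add_sub_cancel, e2, ← add_smul]
  have e3 : (m.choose (j + 1) : ℂ) * (j + 1 : ℕ) = m.choose j * (m - j : ℕ) := by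
    exact_mod_cast Nat.choose_succ_right_eq m j
  have e4 : (-1 : ℂ) ^ (m - j) = -(-1 : ℂ) ^ (m - j - 1) := by
    obtain ⟨k, hk⟩ : ∃ k, m - j = k + 1 := ⟨m - j - 1, by omega⟩
    rw [hk, pow_succ, Nat.add_sub_cancel]
    ring
  rw [mul_assoc, e3, e4]
  simp only [neg_mul, mul_assoc, add_neg_cancel, zero_smul]

/-- The weight j - 1 of `ℓ j` under [d, ·] is cancelled by the weight of p^(j-1). -/
theorem commute_transform_lie (h : (p : R) * d = d * p + p)
    (hℓ : ∀ j, d * ℓ j = ℓ j * d + ((j : ℂ) - 1) • ℓ j) (m : ℕ) :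
    Commute d (transform p d ℓ m) := by
  refine Commute.sum_right _ _ _ fun j _ => ?_
  rw [transformCoeff, mul_smul_comm]
  refine Commute.smul_right ?_ _
  have e := zpow_mul_of_lie h ((j : ℤ) - 1)
  have c : Commute d (falling d (m - j)) := commute_falling (Commute.refl d) _
  push_cast at e
  rw [Commute, SemiconjBy, ← mul_assoc, hℓ, mul_assoc (ℓ j), mul_assoc (falling _ _), e, add_mul,
    add_mul, mul_add, mul_add, smul_mul_assoc, smul_mul_assoc, one_mul, mul_smul_comm,
    mul_smul_comm, mul_assoc (ℓ j), ← mul_assoc d, c.eq, mul_assoc (falling _ _)]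

/-- The coefficients involve only `p` and `d`, so relations in the other variable pass through the
transform. This is what allows the double transform in `SBarSystem.Y` to be treated one variable at
a time. -/
theorem mul_transform {q : R} {ℓ' : ℕ → R} {c : ℂ} (hp : Commute q (p : R)) (hd : Commute q d)
    (hℓ : ∀ j, q * ℓ j = ℓ j * q + c • ℓ' j) (m : ℕ) :
    q * transform p d ℓ m = transform p d ℓ m * q + c • transform p d ℓ' m := by
  simp only [transform, Finset.mul_sum, Finset.sum_mul, Finset.smul_sum, ← Finset.sum_add_distrib]
  refine Finset.sum_congr rfl fun j _ => ?_
  rw [← mul_assoc, hℓ, add_mul, mul_assoc, (commute_transformCoeff hp hd m j).eq, mul_assoc,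
    smul_mul_assoc]

theorem commute_transform {x : R} (hp : Commute x (p : R)) (hd : Commute x d)
    (hℓ : ∀ j, Commute x (ℓ j)) (m : ℕ) : Commute x (transform p d ℓ m) :=
  Commute.sum_right _ _ _ fun j _ => (hℓ j).mul_right (commute_transformCoeff hp hd m j)

end WeylPair

/-! ### Indices and degrees of words -/

/-- The exponent `α₁ + 1` of `t₁` in the Hamiltonian of `L_α`. -/
def YIndex.fst (α : YIndex) : ℕ := (α.1.1 + 1).toNat

/-- The exponent `α₂ + 1` of `t₂` in the Hamiltonian of `L_α`. -/
def YIndex.snd (α : YIndex) : ℕ := (α.1.2 + 1).toNat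

theorem YIndex.coe_fst (α : YIndex) : (α.fst : ℤ) = α.1.1 + 1 :=
  Int.toNat_of_nonneg (by have := α.2.1; omega)

theorem YIndex.coe_snd (α : YIndex) : (α.snd : ℤ) = α.1.2 + 1 :=
  Int.toNat_of_nonneg (by have := α.2.2.1; omega)

/-- The degree `|α| + 1` of `Y_α`. -/
def YIndex.deg (α : YIndex) : ℤ := α.fst + α.snd - 1

theorem YIndex.deg_pos (α : YIndex) : 0 < α.deg := by
  have h1 := α.coe_fst
  have h2 := α.coe_snd
  have h3 := α.2.2.2.1
  unfold YIndex.deg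
  omega

theorem YIndex.exists_of_le {j k : ℕ} (h : 2 ≤ j + k) (h1 : ¬ (j = 1 ∧ k = 1)) :
    ∃ α : YIndex, α.fst = j ∧ α.snd = k := by
  refine ⟨⟨((j : ℤ) - 1, (k : ℤ) - 1), by simp only; omega, by simp only; omega,
    by simp only; omega, ?_⟩, ?_, ?_⟩
  · intro h0
    rw [Prod.ext_iff] at h0
    simp only [Prod.fst_zero, Prod.snd_zero] at h0
    omega
  · simp [YIndex.fst]
  · simp [YIndex.snd]

theorem YIndex.ext' {α β : YIndex} (h1 : α.fst = β.fst) (h2 : α.snd = β.snd) : α = β := by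
  have := α.coe_fst
  have := α.coe_snd
  have := β.coe_fst
  have := β.coe_snd
  exact Subtype.ext (Prod.ext (by omega) (by omega))

/-- The total degree of a word. -/
def wordDeg (l : List YIndex) : ℤ := (l.map YIndex.deg).sum

theorem wordDeg_cons (α : YIndex) (l : List YIndex) : wordDeg (α :: l) = α.deg + wordDeg l := by
  simp [wordDeg]

theorem wordDeg_append (l m : List YIndex) : wordDeg (l ++ m) = wordDeg l + wordDeg m := by
  simp [wordDeg]

theorem wordDeg_nonneg (l : List YIndex) : 0 ≤ wordDeg l := by
  induction l with
  | nil => simp [wordDeg]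
  | cons α l ih =>
    have := α.deg_pos
    rw [wordDeg_cons]
    omega

theorem wordDeg_perm {l m : List YIndex} (h : l.Perm m) : wordDeg l = wordDeg m :=
  (h.map _).sum_eq

/-! ### Algebras satisfying the relations of the localized enveloping algebra -/

/-- Elements `p = ∂₁`, `q = ∂₂` (invertible), `d = d₁`, `e = d₂` and
`L j k = L_(j - 1, k - 1)` of an algebra that satisfy the relations of `S̄₂`. -/
structure SBarSystem (R : Type*) [Ring R] [Algebra ℂ R] where
  p : Rˣ
  q : Rˣ
  d : R
  e : R
  L : ℕ → ℕ → R
  pq : Commute (p : R) q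
  pd : (p : R) * d = d * p + p
  qe : (q : R) * e = e * q + q
  pe : Commute (p : R) e
  qd : Commute (q : R) d
  de : Commute d e
  pL : ∀ j k, p * L j k = L j k * p + (j : ℂ) • L (j - 1) k
  qL : ∀ j k, q * L j k = L j k * q + (k : ℂ) • L j (k - 1)
  dL : ∀ j k, d * L j k = L j k * d + ((j : ℂ) - 1) • L j k
  eL : ∀ j k, e * L j k = L j k * e + ((k : ℂ) - 1) • L j k
  LL : ∀ j k j' k', L j k * L j' k' - L j' k' * L j k =
    ((k : ℂ) * j' - j * k') • L (j + j' - 1) (k + k' - 1)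
  L_zero_zero : L 0 0 = 0
  L_zero_one : L 0 1 = p
  L_one_zero : L 1 0 = -q
  L_one_one : L 1 1 = d - e

/-- Stability under right multiplication by the generators makes `N` a right module over the
generated algebra; `1 ∈ N` finishes. It serves for normal ordering. -/
theorem mem_of_mem_adjoin {R : Type*} [Ring R] [Algebra ℂ R] {s : Set R} {N : Submodule ℂ R}
    (h1 : 1 ∈ N) (hs : ∀ x ∈ s, ∀ n ∈ N, n * x ∈ N) {c : R} (hc : c ∈ Algebra.adjoin ℂ s) :
    c ∈ N := by
  suffices h : ∀ n ∈ N, n * c ∈ N by simpa using h 1 h1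
  induction hc using Algebra.adjoin_induction with
  | mem x hx => exact hs x hx
  | algebraMap r =>
    intro n hn
    rw [← Algebra.commutes, ← Algebra.smul_def]
    exact N.smul_mem r hn
  | add x y _ _ hx hy => intro n hn; rw [mul_add]; exact add_mem (hx n hn) (hy n hn)
  | mul x y _ _ hx hy => intro n hn; rw [← mul_assoc]; exact hy _ (hx n hn)

namespace SBarSystem

variable {R : Type*} [Ring R] [Algebra ℂ R] (S : SBarSystem R)

/-- The subalgebra generated by `∂₁^{±1}, ∂₂^{±1}, d₁, d₂`. -/
def C : Subalgebra ℂ R :=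
  Algebra.adjoin ℂ {(S.p : R), ((S.p⁻¹ : Rˣ) : R), (S.q : R), ((S.q⁻¹ : Rˣ) : R), S.d, S.e}

/-- The element `Y_(m - 1, n - 1)`. -/
def Y (m n : ℕ) : R := transform S.q S.e (fun k => transform S.p S.d (fun j => S.L j k) m) n

theorem p_mem_C : (S.p : R) ∈ S.C := Algebra.subset_adjoin (by simp)
theorem p_inv_mem_C : ((S.p⁻¹ : Rˣ) : R) ∈ S.C := Algebra.subset_adjoin (by simp)
theorem q_mem_C : (S.q : R) ∈ S.C := Algebra.subset_adjoin (by simp)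
theorem q_inv_mem_C : ((S.q⁻¹ : Rˣ) : R) ∈ S.C := Algebra.subset_adjoin (by simp)
theorem d_mem_C : S.d ∈ S.C := Algebra.subset_adjoin (by simp)
theorem e_mem_C : S.e ∈ S.C := Algebra.subset_adjoin (by simp)

theorem zpow_mem_of_mem {A : Subalgebra ℂ R} {x : Rˣ} (h : (x : R) ∈ A)
    (h' : ((x⁻¹ : Rˣ) : R) ∈ A) (n : ℤ) : ((x ^ n : Rˣ) : R) ∈ A := by
  cases n with
  | ofNat n => simpa using pow_mem h n
  | negSucc n =>
    rw [zpow_negSucc, ← inv_pow, Units.val_pow_eq_pow_val]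
    exact pow_mem h' _

theorem p_zpow_mem_C (n : ℤ) : ((S.p ^ n : Rˣ) : R) ∈ S.C :=
  zpow_mem_of_mem S.p_mem_C S.p_inv_mem_C n

theorem q_zpow_mem_C (n : ℤ) : ((S.q ^ n : Rˣ) : R) ∈ S.C :=
  zpow_mem_of_mem S.q_mem_C S.q_inv_mem_C n

theorem falling_mem {A : Subalgebra ℂ R} {x : R} (h : x ∈ A) (n : ℕ) : falling x n ∈ A := by
  induction n with
  | zero => exact one_mem A
  | succ n ih => exact mul_mem ih (sub_mem h (natCast_mem A n))

theorem transformCoeff_mem {A : Subalgebra ℂ R} {x : Rˣ} {y : R} (h : (x : R) ∈ A)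
    (h' : ((x⁻¹ : Rˣ) : R) ∈ A) (hy : y ∈ A) (m j : ℕ) : transformCoeff x y m j ∈ A :=
  A.smul_mem (mul_mem (falling_mem hy _) (zpow_mem_of_mem h h' _)) _

/-- The coefficient of `L i` in `Y_(m - 1, n - 1)`. -/
def coeff (m n : ℕ) (i : ℕ × ℕ) : R :=
  transformCoeff S.p S.d m i.1 * transformCoeff S.q S.e n i.2

theorem coeff_mem_C (m n : ℕ) (i : ℕ × ℕ) : S.coeff m n i ∈ S.C :=
  mul_mem (transformCoeff_mem S.p_mem_C S.p_inv_mem_C S.d_mem_C _ _)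
    (transformCoeff_mem S.q_mem_C S.q_inv_mem_C S.e_mem_C _ _)

/-- The unit `∂₁^(m - 1) ∂₂^(n - 1)`. -/
def monomialUnit (m n : ℕ) : Rˣ := S.p ^ ((m : ℤ) - 1) * S.q ^ ((n : ℤ) - 1)

theorem coeff_self (m n : ℕ) : S.coeff m n (m, n) = S.monomialUnit m n := by
  simp only [coeff, monomialUnit, transformCoeff_self, Units.val_mul]

theorem monomialUnit_mem_C (m n : ℕ) : (S.monomialUnit m n : R) ∈ S.C := by
  rw [← coeff_self]
  exact S.coeff_mem_C _ _ _

theorem monomialUnit_inv_mem_C (m n : ℕ) : (((S.monomialUnit m n)⁻¹ : Rˣ) : R) ∈ S.C := by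
  rw [monomialUnit, mul_inv_rev, ← zpow_neg, ← zpow_neg, Units.val_mul]
  exact mul_mem (S.q_zpow_mem_C _) (S.p_zpow_mem_C _)

theorem Y_eq_sum (m n : ℕ) : S.Y m n =
    ∑ i ∈ Finset.range (m + 1) ×ˢ Finset.range (n + 1), S.L i.1 i.2 * S.coeff m n i := by
  rw [Finset.sum_product_right, Y, transform]
  simp only [transform, Finset.sum_mul, coeff, mul_assoc]

theorem Y_eq_add_sum (m n : ℕ) : S.Y m n = S.L m n * S.monomialUnit m n +
    ∑ i ∈ (Finset.range (m + 1) ×ˢ Finset.range (n + 1)).erase (m, n),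
      S.L i.1 i.2 * S.coeff m n i := by
  rw [Y_eq_sum, ← Finset.add_sum_erase _ _ (a := (m, n)) (by simp), coeff_self]

theorem lt_of_mem_erase {m n : ℕ} {i : ℕ × ℕ}
    (h : i ∈ (Finset.range (m + 1) ×ˢ Finset.range (n + 1)).erase (m, n)) :
    i.1 + i.2 < m + n := by
  obtain ⟨j, k⟩ := i
  simp only [Finset.mem_erase, ne_eq, Prod.mk.injEq, Finset.mem_product, Finset.mem_range] at h
  simp only
  omega

/-- The coefficient of `L m n` in `Y m n` is a unit with inverse in `C`, and all other terms have
smaller index, so the triangular relation can be inverted. -/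
theorem L_mem_of_Y_mem {N : Submodule ℂ R} (hN : ∀ u ∈ N, ∀ c ∈ S.C, u * c ∈ N) {m n : ℕ}
    (hY : S.Y m n ∈ N) (hL : ∀ j k, j + k < m + n → j ≤ m → k ≤ n → S.L j k ∈ N) :
    S.L m n ∈ N := by
  have h1 : S.L m n * S.monomialUnit m n ∈ N := by
    rw [Y_eq_add_sum] at hY
    refine (N.add_mem_iff_left (sum_mem fun i hi => ?_)).1 hY
    have h2 := Finset.mem_product.1 (Finset.mem_of_mem_erase hi)
    simp only [Finset.mem_range] at h2
    exact hN _ (hL _ _ (lt_of_mem_erase hi) (by omega) (by omega)) _ (S.coeff_mem_C _ _ _)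
  have := hN _ h1 _ (S.monomialUnit_inv_mem_C m n)
  rwa [Units.mul_inv_cancel_right] at this

theorem commute_Y_p (m n : ℕ) : Commute (S.p : R) (S.Y m n) :=
  commute_transform S.pq S.pe (fun k => commute_transform_unit S.pd (fun j => S.pL j k) m) n

theorem commute_Y_d (m n : ℕ) : Commute S.d (S.Y m n) :=
  commute_transform S.qd.symm S.de (fun k => commute_transform_lie S.pd (fun j => S.dL j k) m) n

theorem commute_Y_q (m n : ℕ) : Commute (S.q : R) (S.Y m n) :=
  commute_transform_unit S.qe
    (fun k => mul_transform S.pq.symm S.qd (fun j => S.qL j k) m) n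

theorem commute_Y_e (m n : ℕ) : Commute S.e (S.Y m n) :=
  commute_transform_lie S.qe
    (fun k => mul_transform S.pe.symm S.de.symm (fun j => S.eL j k) m) n

theorem commute_of_mem_C {x c : R} (hp : Commute x (S.p : R)) (hq : Commute x (S.q : R))
    (hd : Commute x S.d) (he : Commute x S.e) (hc : c ∈ S.C) : Commute x c := by
  induction hc using Algebra.adjoin_induction with
  | mem y hy =>
    rcases hy with rfl | rfl | rfl | rfl | rfl | rfl
    exacts [hp, hp.units_inv_right, hq, hq.units_inv_right, hd, he]
  | algebraMap r => exact (Algebra.commutes r x).symm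
  | add x y _ _ hx hy => exact hx.add_right hy
  | mul x y _ _ hx hy => exact hx.mul_right hy

theorem commute_Y_C (m n : ℕ) {c : R} (hc : c ∈ S.C) : Commute (S.Y m n) c :=
  S.commute_of_mem_C (S.commute_Y_p m n).symm (S.commute_Y_q m n).symm (S.commute_Y_d m n).symm
    (S.commute_Y_e m n).symm hc

/-- The product of the `Y_α` along a word. -/
def wordY (l : List YIndex) : R := (l.map fun α => S.Y α.fst α.snd).prod

theorem wordY_cons (α : YIndex) (l : List YIndex) :
    S.wordY (α :: l) = S.Y α.fst α.snd * S.wordY l := by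
  simp [wordY]

theorem commute_wordY_C (l : List YIndex) {c : R} (hc : c ∈ S.C) : Commute (S.wordY l) c := by
  induction l with
  | nil => exact Commute.one_left c
  | cons α l ih => rw [wordY_cons]; exact (S.commute_Y_C _ _ hc).mul_left ih

/-! ### The degree filtration -/

/-- The span of all products of a word of degree at most `n` with an element of `C`. -/
def F (n : ℤ) : Submodule ℂ R :=
  Submodule.span ℂ {u | ∃ (l : List YIndex) (c : R), wordDeg l ≤ n ∧ c ∈ S.C ∧ u = S.wordY l * c}

theorem wordY_mul_mem_F {l : List YIndex} {n : ℤ} (hl : wordDeg l ≤ n) {c : R} (hc : c ∈ S.C) :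
    S.wordY l * c ∈ S.F n :=
  Submodule.subset_span ⟨l, c, hl, hc, rfl⟩

theorem wordY_mem_F {l : List YIndex} {n : ℤ} (hl : wordDeg l ≤ n) : S.wordY l ∈ S.F n := by
  simpa using S.wordY_mul_mem_F hl (one_mem S.C)

theorem F_mono {m n : ℤ} (h : m ≤ n) : S.F m ≤ S.F n :=
  Submodule.span_mono fun _ ⟨l, c, hl, hc, hu⟩ => ⟨l, c, hl.trans h, hc, hu⟩

theorem mem_F_of_mem_C {c : R} (hc : c ∈ S.C) {n : ℤ} (hn : 0 ≤ n) : c ∈ S.F n := by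
  simpa [wordY] using S.wordY_mul_mem_F (l := []) (n := n) (by simpa [wordDeg] using hn) hc

/-- Coefficients from `C` move past words in the Y_α, which centralize `C`. -/
theorem mul_mem_F {m n k : ℤ} (hk : m + n ≤ k) {u v : R} (hu : u ∈ S.F m) (hv : v ∈ S.F n) :
    u * v ∈ S.F k := by
  have h : S.F m * S.F n ≤ S.F k := by
    rw [F, F, Submodule.span_mul_span, Submodule.span_le]
    rintro _ ⟨_, ⟨l, c, hl, hc, rfl⟩, _, ⟨l', c', hl', hc', rfl⟩, rfl⟩
    have e : S.wordY l * c * (S.wordY l' * c') = S.wordY (l ++ l') * (c * c') := by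
      rw [mul_assoc, ← mul_assoc c, ← (S.commute_wordY_C l' hc).eq]
      simp [wordY, mul_assoc]
    simp only [SetLike.mem_coe]
    rw [e]
    exact S.wordY_mul_mem_F (by rw [wordDeg_append]; omega) (mul_mem hc hc')
  exact h (Submodule.mul_mem_mul hu hv)

theorem mul_mem_F_right {n : ℤ} {u c : R} (hu : u ∈ S.F n) (hc : c ∈ S.C) : u * c ∈ S.F n :=
  S.mul_mem_F (by omega) hu (S.mem_F_of_mem_C hc le_rfl)

theorem mul_mem_F_left {n : ℤ} {u c : R} (hu : u ∈ S.F n) (hc : c ∈ S.C) : c * u ∈ S.F n :=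
  S.mul_mem_F (by omega) (S.mem_F_of_mem_C hc le_rfl) hu

theorem Y_mem_F (α : YIndex) : S.Y α.fst α.snd ∈ S.F α.deg := by
  simpa [wordY] using S.wordY_mem_F (l := [α]) (n := α.deg) (by simp [wordDeg])

theorem L_mem_C_of_lt {j k : ℕ} (h : ¬ (2 ≤ j + k ∧ ¬ (j = 1 ∧ k = 1))) : S.L j k ∈ S.C := by
  obtain ⟨rfl, rfl⟩ | ⟨rfl, rfl⟩ | ⟨rfl, rfl⟩ | ⟨rfl, rfl⟩ :
      (j = 0 ∧ k = 0) ∨ (j = 0 ∧ k = 1) ∨ (j = 1 ∧ k = 0) ∨ (j = 1 ∧ k = 1) := by omega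
  · rw [S.L_zero_zero]; exact zero_mem _
  · rw [S.L_zero_one]; exact S.p_mem_C
  · rw [S.L_one_zero]; exact neg_mem S.q_mem_C
  · rw [S.L_one_one]; exact sub_mem S.d_mem_C S.e_mem_C

theorem L_mem_F (j k : ℕ) : S.L j k ∈ S.F ((j : ℤ) + k - 1) := by
  induction hN : j + k using Nat.strong_induction_on generalizing j k with
  | _ N ih =>
    -- For j = k = 0 the filtration index is -1, where membership in `C` would not help; it holds
    -- because `L 0 0 = 0`.
    by_cases h0 : j = 0 ∧ k = 0
    · rw [h0.1, h0.2, S.L_zero_zero]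
      exact zero_mem _
    by_cases h : 2 ≤ j + k ∧ ¬ (j = 1 ∧ k = 1)
    · obtain ⟨α, rfl, rfl⟩ := YIndex.exists_of_le h.1 h.2
      refine S.L_mem_of_Y_mem (fun u hu c hc => S.mul_mem_F_right hu hc) (S.Y_mem_F α) ?_
      intro j k hjk _ _
      exact S.F_mono (by omega) (ih (j + k) (by omega) j k rfl)
    · exact S.mem_F_of_mem_C (S.L_mem_C_of_lt h) (by omega)

/-- The map x ↦ [x, y] is a derivation with [x⁻¹, y] = -x⁻¹ [x, y] x⁻¹, and `F n` is stable under
multiplication by `C` on both sides. -/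
theorem zpow_commutator_mem_F {x : Rˣ} (hx : (x : R) ∈ S.C) (hx' : ((x⁻¹ : Rˣ) : R) ∈ S.C) {y : R}
    {n : ℤ} (h : (x : R) * y - y * x ∈ S.F n) (m : ℤ) :
    ((x ^ m : Rˣ) : R) * y - y * ((x ^ m : Rˣ) : R) ∈ S.F n := by
  have hinv : ((x⁻¹ : Rˣ) : R) * y - y * ((x⁻¹ : Rˣ) : R) ∈ S.F n := by
    have e : ((x⁻¹ : Rˣ) : R) * y - y * ((x⁻¹ : Rˣ) : R) =
        ((x⁻¹ : Rˣ) : R) * -(x * y - y * x) * ((x⁻¹ : Rˣ) : R) := by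
      simp [mul_sub, sub_mul, mul_assoc]
    rw [e]
    exact S.mul_mem_F_right (S.mul_mem_F_left (neg_mem h) hx') hx'
  have hstep : ∀ m : ℤ, ∀ z : Rˣ, ((z : Rˣ) : R) ∈ S.C → (z : R) * y - y * z ∈ S.F n →
      ((x ^ m : Rˣ) : R) * y - y * ((x ^ m : Rˣ) : R) ∈ S.F n →
      ((x ^ m * z : Rˣ) : R) * y - y * ((x ^ m * z : Rˣ) : R) ∈ S.F n := by
    intro m z hz h1 h2
    have e : ((x ^ m * z : Rˣ) : R) * y - y * ((x ^ m * z : Rˣ) : R) =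
        ((x ^ m : Rˣ) : R) * (z * y - y * z) +
          (((x ^ m : Rˣ) : R) * y - y * ((x ^ m : Rˣ) : R)) * z := by
      simp only [Units.val_mul, mul_sub, sub_mul, mul_assoc]
      abel
    rw [e]
    exact add_mem (S.mul_mem_F_left h1 (zpow_mem_of_mem hx hx' m)) (S.mul_mem_F_right h2 hz)
  induction m using Int.induction_on with
  | zero => simp
  | succ m ih => rw [zpow_add_one]; exact hstep _ _ hx h ih
  | pred m ih => rw [zpow_sub_one]; exact hstep _ _ hx' hinv ih

theorem monomialUnit_commutator_mem_F (m n j k : ℕ) :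
    (S.monomialUnit m n : R) * S.L j k - S.L j k * S.monomialUnit m n ∈ S.F ((j : ℤ) + k - 2) := by
  have h1 : ((S.p ^ ((m : ℤ) - 1) : Rˣ) : R) * S.L j k -
      S.L j k * ((S.p ^ ((m : ℤ) - 1) : Rˣ) : R) ∈ S.F ((j : ℤ) + k - 2) := by
    refine S.zpow_commutator_mem_F S.p_mem_C S.p_inv_mem_C ?_ _
    rw [S.pL, add_sub_cancel_left]
    cases j with
    | zero => simp
    | succ j => exact Submodule.smul_mem _ _ (S.F_mono (by push_cast; omega) (S.L_mem_F _ _))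
  have h2 : ((S.q ^ ((n : ℤ) - 1) : Rˣ) : R) * S.L j k -
      S.L j k * ((S.q ^ ((n : ℤ) - 1) : Rˣ) : R) ∈ S.F ((j : ℤ) + k - 2) := by
    refine S.zpow_commutator_mem_F S.q_mem_C S.q_inv_mem_C ?_ _
    rw [S.qL, add_sub_cancel_left]
    cases k with
    | zero => simp
    | succ k => exact Submodule.smul_mem _ _ (S.F_mono (by push_cast; omega) (S.L_mem_F _ _))
  have e : (S.monomialUnit m n : R) * S.L j k - S.L j k * S.monomialUnit m n =
      ((S.p ^ ((m : ℤ) - 1) : Rˣ) : R) * (((S.q ^ ((n : ℤ) - 1) : Rˣ) : R) * S.L j k -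
        S.L j k * ((S.q ^ ((n : ℤ) - 1) : Rˣ) : R)) +
      (((S.p ^ ((m : ℤ) - 1) : Rˣ) : R) * S.L j k - S.L j k * ((S.p ^ ((m : ℤ) - 1) : Rˣ) : R)) *
        ((S.q ^ ((n : ℤ) - 1) : Rˣ) : R) := by
    simp only [monomialUnit, Units.val_mul, mul_sub, sub_mul, mul_assoc]
    abel
  rw [e]
  exact add_mem (S.mul_mem_F_left h2 (S.p_zpow_mem_C _)) (S.mul_mem_F_right h1 (S.q_zpow_mem_C _))

theorem L_commutator_mem_F (j k j' k' : ℕ) :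
    S.L j k * S.L j' k' - S.L j' k' * S.L j k ∈ S.F ((j : ℤ) + k + j' + k' - 3) := by
  rw [S.LL]
  -- In these cases truncated subtraction gives an index of too high degree, but the structure
  -- constant is zero.
  by_cases h : j + j' = 0 ∨ k + k' = 0
  · have : (k : ℂ) * j' - j * k' = 0 := by
      rcases h with h | h
      · obtain ⟨rfl, rfl⟩ : j = 0 ∧ j' = 0 := by omega
        simp
      · obtain ⟨rfl, rfl⟩ : k = 0 ∧ k' = 0 := by omega
        simp
    rw [this, zero_smul]
    exact zero_mem _
  · refine Submodule.smul_mem _ _ (S.F_mono ?_ (S.L_mem_F _ _))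
    omega

/-- Only the leading summand needs care: its coefficient is a monomial in ∂₁, ∂₂, whose commutator
with `L j k` drops a degree. The other summands of `Y m n` start one degree lower, so for their
coefficients a commutator of the degree of `L j k` is good enough. -/
theorem Y_L_commutator_mem_F (m n j k : ℕ) :
    S.Y m n * S.L j k - S.L j k * S.Y m n ∈ S.F ((m : ℤ) + n + j + k - 3) := by
  have e : ∀ x y c : R, x * c * y - y * (x * c) = x * (c * y - y * c) + (x * y - y * x) * c := by
    intro x y c
    noncomm_ring
  rw [Y_eq_add_sum, add_mul, mul_add, Finset.sum_mul, Finset.mul_sum, add_sub_add_comm,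
    ← Finset.sum_sub_distrib]
  refine add_mem ?_ (sum_mem fun i hi => ?_)
  · rw [e]
    refine add_mem ?_ (S.mul_mem_F_right ?_ (S.monomialUnit_mem_C _ _))
    · exact S.mul_mem_F (by omega) (S.L_mem_F _ _) (S.monomialUnit_commutator_mem_F _ _ _ _)
    · exact S.F_mono (by omega) (S.L_commutator_mem_F _ _ _ _)
  · have hlt := lt_of_mem_erase hi
    rw [e]
    refine add_mem ?_ (S.mul_mem_F_right ?_ (S.coeff_mem_C _ _ _))
    · exact S.mul_mem_F (n := (j : ℤ) + k - 1) (by omega) (S.L_mem_F _ _)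
        (sub_mem (S.mul_mem_F_left (S.L_mem_F _ _) (S.coeff_mem_C _ _ _))
          (S.mul_mem_F_right (S.L_mem_F _ _) (S.coeff_mem_C _ _ _)))
    · exact S.F_mono (by omega) (S.L_commutator_mem_F _ _ _ _)

/-- Since Y_α commutes with the coefficients of Y_β, the commutator reduces to those with the L's.
The degree drop makes sorting words harmless modulo lower terms. -/
theorem Y_commutator_mem_F (α β : YIndex) :
    S.Y α.fst α.snd * S.Y β.fst β.snd - S.Y β.fst β.snd * S.Y α.fst α.snd ∈
      S.F (α.deg + β.deg - 1) := by
  rw [S.Y_eq_sum β.fst β.snd, Finset.mul_sum, Finset.sum_mul, ← Finset.sum_sub_distrib]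
  refine sum_mem fun i hi => ?_
  have hi' := Finset.mem_product.1 hi
  simp only [Finset.mem_range] at hi'
  rw [mul_assoc, ← (S.commute_Y_C _ _ (S.coeff_mem_C _ _ _)).eq, ← mul_assoc, ← mul_assoc,
    ← sub_mul]
  refine S.mul_mem_F_right (S.F_mono ?_ (S.Y_L_commutator_mem_F _ _ _ _)) (S.coeff_mem_C _ _ _)
  unfold YIndex.deg
  omega

theorem wordY_sub_mem_F {l m : List YIndex} (h : l.Perm m) :
    S.wordY l - S.wordY m ∈ S.F (wordDeg l - 1) := by
  induction h with
  | nil => simp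
  | cons α _ ih =>
    rw [wordY_cons, wordY_cons, ← mul_sub, wordDeg_cons]
    exact S.mul_mem_F (by omega) (S.Y_mem_F α) ih
  | swap α β l =>
    rw [wordY_cons, wordY_cons, wordY_cons, wordY_cons, ← mul_assoc, ← mul_assoc, ← sub_mul,
      wordDeg_cons, wordDeg_cons]
    exact S.mul_mem_F (by omega) (S.Y_commutator_mem_F β α) (S.wordY_mem_F le_rfl)
  | @trans l₁ l₂ l₃ h1 h2 ih1 ih2 =>
    rw [← sub_add_sub_cancel _ (S.wordY l₂)]
    rw [← wordDeg_perm h1] at ih2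
    exact add_mem ih1 ih2

theorem F_le_of_neg {n : ℤ} (hn : n < 0) (N : Submodule ℂ R) : S.F n ≤ N := by
  refine Submodule.span_le.2 ?_
  rintro _ ⟨l, c, hl, -, -⟩
  have := wordDeg_nonneg l
  omega

/-- A submodule contains `F n` if modulo `F m` it contains every product of a sorted word of degree
`m + 1 ≤ n` with an element of `C`. -/
theorem F_le [LinearOrder YIndex] {n : ℤ} {N : Submodule ℂ R}
    (h : ∀ (s : Multiset YIndex) (c : R), wordDeg s.sort ≤ n → c ∈ S.C →
      S.F (wordDeg s.sort - 1) ≤ N → S.wordY s.sort * c ∈ N) : S.F n ≤ N := by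
  have key : ∀ (k : ℕ) (m : ℤ), m < k → m ≤ n → S.F m ≤ N := by
    intro k
    induction k with
    | zero => intro m hm _; exact S.F_le_of_neg (by simpa using hm) N
    | succ k ih =>
      intro m hm hmn
      refine Submodule.span_le.2 ?_
      rintro _ ⟨l, c, hl, hc, rfl⟩
      have hp : l.Perm (l : Multiset YIndex).sort := by
        rw [← Multiset.coe_eq_coe, Multiset.sort_eq]
      have hdeg := wordDeg_perm hp
      have hF : S.F (wordDeg l - 1) ≤ N := ih _ (by push_cast at hm; omega) (by omega)
      have e : S.wordY l * c = S.wordY (l : Multiset YIndex).sort * c +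
          (S.wordY l - S.wordY (l : Multiset YIndex).sort) * c := by
        rw [sub_mul, add_sub_cancel]
      rw [SetLike.mem_coe, e]
      refine add_mem (h _ _ (by omega) hc (by rwa [← hdeg])) (hF ?_)
      exact S.mul_mem_F_right (S.wordY_sub_mem_F hp) hc
  exact key (n.toNat + 1) n (by omega) le_rfl

/-! ### The centralizer of `∂₁, ∂₂, d₁, d₂` -/

theorem commute_of_mem_weylSpan {x : R} {p : Rˣ} {d : R} (hp : Commute x (p : R))
    (hd : Commute x d) {u : R} (hu : u ∈ weylSpan p d) : Commute x u := by
  induction hu using Submodule.span_induction with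
  | mem _ h =>
    obtain ⟨⟨a, n⟩, rfl⟩ := h
    exact (commute_falling hd a).mul_right (hp.units_zpow_right n)
  | zero => exact Commute.zero_right x
  | add x y _ _ hx hy => exact hx.add_right hy
  | smul c x _ hx => exact hx.smul_right c

/-- Normal ordering: right multiplication by `q^{±1}, e` acts on the second factor, while `p^{±1},
d` commute with that factor and act on the first. -/
theorem C_le_weylSpan_mul :
    Subalgebra.toSubmodule S.C ≤ weylSpan S.p S.d * weylSpan S.q S.e := by
  intro c hc
  rw [Subalgebra.mem_toSubmodule] at hc
  refine mem_of_mem_adjoin ?_ ?_ hc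
  · simpa using Submodule.mul_mem_mul (one_mem_weylSpan S.p S.d) (one_mem_weylSpan S.q S.e)
  have hr : ∀ x : R, (∀ v ∈ weylSpan S.q S.e, v * x ∈ weylSpan S.q S.e) →
      ∀ n ∈ weylSpan S.p S.d * weylSpan S.q S.e,
        n * x ∈ weylSpan S.p S.d * weylSpan S.q S.e := by
    intro x hx n hn
    induction hn using Submodule.mul_induction_on' with
    | mem_mul_mem u hu v hv => rw [mul_assoc]; exact Submodule.mul_mem_mul hu (hx v hv)
    | add u _ v _ hu hv => rw [add_mul]; exact add_mem hu hv
  have hl : ∀ x : R, Commute x (S.q : R) → Commute x S.e →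
      (∀ v ∈ weylSpan S.p S.d, v * x ∈ weylSpan S.p S.d) →
      ∀ n ∈ weylSpan S.p S.d * weylSpan S.q S.e,
        n * x ∈ weylSpan S.p S.d * weylSpan S.q S.e := by
    intro x hq he hx n hn
    induction hn using Submodule.mul_induction_on' with
    | mem_mul_mem u hu v hv =>
      rw [mul_assoc, ← (commute_of_mem_weylSpan hq he hv).eq, ← mul_assoc]
      exact Submodule.mul_mem_mul (hx u hu) hv
    | add u _ v _ hu hv => rw [add_mul]; exact add_mem hu hv
  intro x hx
  rcases hx with rfl | rfl | rfl | rfl | rfl | rfl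
  · exact hl _ S.pq S.pe fun v hv => by simpa using weylSpan_mul_zpow hv 1
  · exact hl _ S.pq.units_inv_left S.pe.units_inv_left fun v hv => by
      simpa using weylSpan_mul_zpow hv (-1)
  · exact hr _ fun v hv => by simpa using weylSpan_mul_zpow hv 1
  · exact hr _ fun v hv => by simpa using weylSpan_mul_zpow hv (-1)
  · exact hl _ S.qd.symm S.de fun v hv => weylSpan_mul S.pd hv
  · exact hr _ fun v hv => weylSpan_mul S.qe hv

/-- The centralizer of `∂₁, ∂₂, d₁, d₂`. -/
def Z : Subalgebra ℂ R := Subalgebra.centralizer ℂ {(S.p : R), (S.q : R), S.d, S.e}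

theorem mem_Z_iff {u : R} : u ∈ S.Z ↔
    Commute u (S.p : R) ∧ Commute u (S.q : R) ∧ Commute u S.d ∧ Commute u S.e := by
  simp only [Z, Subalgebra.mem_centralizer_iff, Set.mem_insert_iff, Set.mem_singleton_iff,
    forall_eq_or_imp, forall_eq, Commute, SemiconjBy, eq_comm]

/-- `mem_of_commute` is used twice. It strips off the pair `(q, e)` with `V * weylSpan S.p S.d` in
the role of the commuting submodule, and the pair `(p, d)` with `V` itself. -/
theorem mem_of_mem_mul_C {V : Submodule ℂ R} (hV : V ≤ Subalgebra.toSubmodule S.Z) {u : R}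
    (hu : u ∈ V * Subalgebra.toSubmodule S.C) (huZ : u ∈ S.Z) : u ∈ V := by
  have hV' := fun v hv => S.mem_Z_iff.1 (hV (x := v) hv)
  obtain ⟨hp, hq, hd, he⟩ := S.mem_Z_iff.1 huZ
  have hcomm : ∀ x : R, (∀ v ∈ V, Commute v x) → Commute x (S.p : R) → Commute x S.d →
      ∀ v ∈ V * weylSpan S.p S.d, Commute v x := by
    intro x h1 h2 h3 v hv
    induction hv using Submodule.mul_induction_on' with
    | mem_mul_mem u hu v hv =>
      exact (h1 u hu).mul_left (commute_of_mem_weylSpan h2 h3 hv).symm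
    | add u _ v _ hu hv => exact hu.add_left hv
  refine mem_of_commute S.pd (fun v hv => (hV' v hv).1) (fun v hv => (hV' v hv).2.2.1) ?_ hp hd
  refine mem_of_commute S.qe ?_ ?_ ?_ hq he
  · exact hcomm _ (fun v hv => (hV' v hv).2.1) S.pq.symm S.qd
  · exact hcomm _ (fun v hv => (hV' v hv).2.2.2) S.pe.symm S.de.symm
  · rw [mul_assoc]
    exact (Submodule.mul_le.2 fun v hv c hc =>
      Submodule.mul_mem_mul hv (S.C_le_weylSpan_mul hc)) hu

theorem Y_mem_Z (m n : ℕ) : S.Y m n ∈ S.Z :=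
  S.mem_Z_iff.2 ⟨(S.commute_Y_p m n).symm, (S.commute_Y_q m n).symm, (S.commute_Y_d m n).symm,
    (S.commute_Y_e m n).symm⟩

theorem wordY_mem_Z (l : List YIndex) : S.wordY l ∈ S.Z := by
  refine list_prod_mem fun x hx => ?_
  obtain ⟨α, -, rfl⟩ := List.mem_map.1 hx
  exact S.Y_mem_Z _ _

theorem commute_Z_C {u c : R} (hu : u ∈ S.Z) (hc : c ∈ S.C) : Commute u c := by
  obtain ⟨hp, hq, hd, he⟩ := S.mem_Z_iff.1 hu
  exact S.commute_of_mem_C hp hq hd he hc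

section Generation

variable (hgen : ∀ A : Subalgebra ℂ R, S.C ≤ A → (∀ j k, S.L j k ∈ A) → A = ⊤)
include hgen

theorem exists_mem_F (u : R) : ∃ n, u ∈ S.F n := by
  let A : Subalgebra ℂ R :=
    { carrier := {u | ∃ n, u ∈ S.F n}
      mul_mem' := fun ⟨m, hm⟩ ⟨n, hn⟩ => ⟨m + n, S.mul_mem_F le_rfl hm hn⟩
      add_mem' := fun ⟨m, hm⟩ ⟨n, hn⟩ =>
        ⟨max m n, add_mem (S.F_mono (le_max_left _ _) hm) (S.F_mono (le_max_right _ _) hn)⟩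
      algebraMap_mem' := fun r => ⟨0, S.mem_F_of_mem_C (S.C.algebraMap_mem r) le_rfl⟩ }
  have hA : A = ⊤ := hgen A (fun c hc => ⟨0, S.mem_F_of_mem_C hc le_rfl⟩)
    (fun j k => ⟨_, S.L_mem_F j k⟩)
  have hu : u ∈ A := hA ▸ Algebra.mem_top
  exact hu

/-- The sorted words span the centralizer. -/
theorem mem_span_wordY [LinearOrder YIndex] {u : R} (hu : u ∈ S.Z) :
    u ∈ Submodule.span ℂ (Set.range fun s : Multiset YIndex => S.wordY s.sort) := by
  obtain ⟨n, hn⟩ := S.exists_mem_F hgen u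
  refine S.mem_of_mem_mul_C ?_ ?_ hu
  · refine Submodule.span_le.2 ?_
    rintro _ ⟨s, rfl⟩
    exact S.wordY_mem_Z _
  -- Sorted words times `C` exhaust every `F n`; the factor `C` has been removed by
  -- `mem_of_mem_mul_C`.
  · refine S.F_le (fun s c _ hc _ => ?_) hn
    exact Submodule.mul_mem_mul (Submodule.subset_span ⟨s, rfl⟩) hc

/-- A subalgebra of the centralizer is all of it, as soon as it contains `Y_(1,-1)`, `Y_(-1,1)` and
`Y_(0,1)`. -/
theorem eq_Z_of_Y_mem {G : Subalgebra ℂ R} (hG : G ≤ S.Z) (h20 : S.Y 2 0 ∈ G) (h02 : S.Y 0 2 ∈ G)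
    (h12 : S.Y 1 2 ∈ G) : G = S.Z := by
  -- G · C, which is closed under multiplication because `G` centralizes `C`.
  let N : Submodule ℂ R := Subalgebra.toSubmodule G * Subalgebra.toSubmodule S.C
  have hGN : ∀ g ∈ G, g ∈ N := fun g hg => by
    simpa using Submodule.mul_mem_mul (M := Subalgebra.toSubmodule G)
      (N := Subalgebra.toSubmodule S.C) hg (one_mem S.C)
  have hCN : ∀ c ∈ S.C, c ∈ N := fun c hc => by
    simpa using Submodule.mul_mem_mul (M := Subalgebra.toSubmodule G)
      (N := Subalgebra.toSubmodule S.C) (one_mem G) hc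
  have hmul : ∀ u v, u ∈ N → v ∈ N → u * v ∈ N := by
    intro u v hu hv
    have h : N * N ≤ N := by
      refine Submodule.mul_le.2 fun u hu v hv => ?_
      induction hu using Submodule.mul_induction_on' with
      | mem_mul_mem g hg c hc =>
        induction hv using Submodule.mul_induction_on' with
        | mem_mul_mem g' hg' c' hc' =>
          have e : g * c * (g' * c') = g * g' * (c * c') := by
            rw [mul_assoc, ← mul_assoc c, ← (S.commute_Z_C (hG hg') hc).eq]
            simp only [mul_assoc]
          rw [e]
          exact Submodule.mul_mem_mul (mul_mem (S := Subalgebra ℂ R) hg hg')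
            (mul_mem (S := Subalgebra ℂ R) hc hc')
        | add u _ v _ hu hv => rw [mul_add]; exact add_mem hu hv
      | add u _ v _ hu hv => rw [add_mul]; exact add_mem hu hv
    exact h (Submodule.mul_mem_mul hu hv)
  let A : Subalgebra ℂ R := N.toSubalgebra (hCN 1 (one_mem _)) hmul
  have hNC : ∀ u ∈ N, ∀ c ∈ S.C, u * c ∈ N := fun u hu c hc => hmul u c hu (hCN c hc)
  have hLC : ∀ j k, ¬ (2 ≤ j + k ∧ ¬ (j = 1 ∧ k = 1)) → S.L j k ∈ N := fun j k h =>
    hCN _ (S.L_mem_C_of_lt h)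
  have hL20 : S.L 2 0 ∈ N := S.L_mem_of_Y_mem hNC (hGN _ h20)
    fun j k _ _ _ => hLC j k (by omega)
  have hL02 : S.L 0 2 ∈ N := S.L_mem_of_Y_mem hNC (hGN _ h02)
    fun j k _ _ _ => hLC j k (by omega)
  have hL12 : S.L 1 2 ∈ N := by
    refine S.L_mem_of_Y_mem hNC (hGN _ h12) fun j k _ _ _ => ?_
    by_cases h : j = 0 ∧ k = 2
    · rw [h.1, h.2]
      exact hL02
    · exact hLC j k (by omega)
  have hbr : ∀ j k j' k', S.L j k ∈ N → S.L j' k' ∈ N → (k : ℂ) * j' - j * k' ≠ 0 →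
      S.L (j + j' - 1) (k + k' - 1) ∈ N := by
    intro j k j' k' h1 h2 h3
    rw [← Submodule.smul_mem_iff _ h3, ← S.LL]
    exact sub_mem (hmul _ _ h1 h2) (hmul _ _ h2 h1)
  -- Bracketing with `L 1 2` raises the second index along j = 0, with coefficient k + 1. Below,
  -- bracketing `L j (k + 1)` with `L 2 0` gives `L (j + 1) k` with coefficient 2(k + 1), which
  -- reaches all indices.
  have hL0 : ∀ k, S.L 0 k ∈ N := by
    intro k
    induction k with
    | zero => exact hLC 0 0 (by omega)
    | succ k ih =>
      cases k with
      | zero => exact hLC 0 1 (by omega)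
      | succ k =>
        have := hbr 0 (k + 1) 1 2 ih hL12 (by simpa using Nat.cast_add_one_ne_zero k)
        simpa using this
  have hL : ∀ j k, S.L j k ∈ N := by
    intro j
    induction j with
    | zero => exact hL0
    | succ j ih =>
      intro k
      have := hbr j (k + 1) 2 0 (ih _) hL20 (by simpa using Nat.cast_add_one_ne_zero k)
      simpa using this
  have hA : A = ⊤ := hgen A (fun c hc => hCN c hc) hL
  refine le_antisymm hG fun u hu => ?_
  have huA : u ∈ A := hA ▸ Algebra.mem_top
  exact S.mem_of_mem_mul_C (V := Subalgebra.toSubmodule G) hG huA hu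

end Generation

/-! ### Linear independence of the sorted words -/

/-- The monomial `d₁^a d₂^b ∂₁^m ∂₂^n`. -/
def cMonomial (x : (ℕ × ℕ) × (ℤ × ℤ)) : R :=
  S.d ^ x.1.1 * S.e ^ x.1.2 * ((S.p ^ x.2.1 * S.q ^ x.2.2 : Rˣ) : R)

/-- Normal ordering again: moving d_i to the left past ∂_i^m only adds the scalar m. -/
theorem mem_span_cMonomial {c : R} (hc : c ∈ S.C) :
    c ∈ Submodule.span ℂ (Set.range S.cMonomial) := by
  have hpq := S.pq.units_of_val
  have hr : ∀ x : R, (∀ y, S.cMonomial y * x ∈ Submodule.span ℂ (Set.range S.cMonomial)) →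
      ∀ n ∈ Submodule.span ℂ (Set.range S.cMonomial),
        n * x ∈ Submodule.span ℂ (Set.range S.cMonomial) := by
    intro x hx n hn
    induction hn using Submodule.span_induction with
    | mem _ h => obtain ⟨y, rfl⟩ := h; exact hx y
    | zero => simp
    | add u v _ _ hu hv => rw [add_mul]; exact add_mem hu hv
    | smul c u _ hu => rw [smul_mul_assoc]; exact Submodule.smul_mem _ _ hu
  have hp : ∀ (k : ℤ) y, S.cMonomial y * ((S.p ^ k : Rˣ) : R) ∈
      Submodule.span ℂ (Set.range S.cMonomial) := by
    rintro k ⟨⟨a, b⟩, m, n⟩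
    refine Submodule.subset_span ⟨((a, b), (m + k, n)), ?_⟩
    have h1 : S.p ^ (m + k) * S.q ^ n = S.p ^ m * S.q ^ n * S.p ^ k := by
      rw [mul_assoc, ← (hpq.zpow_zpow k n).eq, ← mul_assoc, ← zpow_add]
    simp only [cMonomial]
    rw [h1, Units.val_mul _ (S.p ^ k), ← mul_assoc]
  have hq : ∀ (k : ℤ) y, S.cMonomial y * ((S.q ^ k : Rˣ) : R) ∈
      Submodule.span ℂ (Set.range S.cMonomial) := by
    rintro k ⟨⟨a, b⟩, m, n⟩
    refine Submodule.subset_span ⟨((a, b), (m, n + k)), ?_⟩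
    simp only [cMonomial]
    rw [zpow_add, ← mul_assoc (S.p ^ m), Units.val_mul _ (S.q ^ k), ← mul_assoc]
  have h1 : 1 ∈ Submodule.span ℂ (Set.range S.cMonomial) :=
    Submodule.subset_span ⟨((0, 0), (0, 0)), by simp [cMonomial]⟩
  refine mem_of_mem_adjoin h1 ?_ hc
  intro x hx
  refine hr x ?_
  rcases hx with rfl | rfl | rfl | rfl | rfl | rfl
  · simpa using hp 1
  · simpa using hp (-1)
  · simpa using hq 1
  · simpa using hq (-1)
  · rintro ⟨⟨a, b⟩, m, n⟩
    have e : S.cMonomial ((a, b), (m, n)) * S.d = S.cMonomial ((a + 1, b), (m, n)) +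
        (m : ℂ) • S.cMonomial ((a, b), (m, n)) := by
      have h1 : S.d ^ a * S.e ^ b * S.d = S.d ^ (a + 1) * S.e ^ b := by
        rw [mul_assoc, ← (S.de.pow_right b).eq, ← mul_assoc, ← pow_succ]
      simp only [cMonomial, Units.val_mul]
      rw [mul_assoc, mul_assoc ((S.p ^ m : Rˣ) : R), (S.qd.units_zpow_left n).eq,
        ← mul_assoc ((S.p ^ m : Rˣ) : R), zpow_mul_of_lie S.pd, add_mul, add_mul, smul_mul_assoc,
        smul_mul_assoc, one_mul, mul_add, mul_smul_comm, mul_assoc S.d, ← mul_assoc _ S.d, h1]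
    rw [e]
    exact add_mem (Submodule.subset_span ⟨_, rfl⟩)
      (Submodule.smul_mem _ _ (Submodule.subset_span ⟨_, rfl⟩))
  · rintro ⟨⟨a, b⟩, m, n⟩
    have e : S.cMonomial ((a, b), (m, n)) * S.e = S.cMonomial ((a, b + 1), (m, n)) +
        (n : ℂ) • S.cMonomial ((a, b), (m, n)) := by
      simp only [cMonomial, Units.val_mul]
      rw [mul_assoc, mul_assoc ((S.p ^ m : Rˣ) : R), zpow_mul_of_lie S.qe, add_mul, smul_mul_assoc,
        one_mul, mul_add, mul_add, mul_smul_comm, mul_smul_comm, ← mul_assoc _ S.e,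
        (S.pe.units_zpow_left m).eq, mul_assoc S.e, ← mul_assoc _ S.e,
        mul_assoc _ _ S.e, ← pow_succ]
    rw [e]
    exact add_mem (Submodule.subset_span ⟨_, rfl⟩)
      (Submodule.smul_mem _ _ (Submodule.subset_span ⟨_, rfl⟩))

/-- The product of the `L_α` along a word. -/
def wordL (l : List YIndex) : R := (l.map fun α => S.L α.fst α.snd).prod

/-- The exponent of `∂₁^m ∂₂^n` in the leading term of a word in the `Y_α`. -/
def wordExp (l : List YIndex) : ℤ × ℤ :=
  ((l.map fun α => (α.fst : ℤ) - 1).sum, (l.map fun α => (α.snd : ℤ) - 1).sum)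

/-- The unit in the leading term of the first letter passes through the remaining word in the Y's,
which centralizes `C`. So all units collect on the right, and lower terms of any letter lower the
total degree. -/
theorem wordY_sub_wordL_mem_F (l : List YIndex) :
    S.wordY l - S.wordL l * ((S.p ^ (wordExp l).1 * S.q ^ (wordExp l).2 : Rˣ) : R) ∈
      S.F (wordDeg l - 1) := by
  induction l with
  | nil => simp [wordY, wordL, wordExp]
  | cons α l ih =>
    have hpq := S.pq.units_of_val
    have e1 : (S.p ^ (wordExp (α :: l)).1 * S.q ^ (wordExp (α :: l)).2 : Rˣ) =
        (S.p ^ (wordExp l).1 * S.q ^ (wordExp l).2) * S.monomialUnit α.fst α.snd := by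
      simp only [wordExp, List.map_cons, List.sum_cons, monomialUnit]
      rw [add_comm, zpow_add, add_comm, zpow_add, mul_assoc, mul_assoc,
        ← mul_assoc (S.p ^ _) (S.q ^ _), (hpq.zpow_zpow _ _).eq, mul_assoc]
    set u := (S.p ^ (wordExp l).1 * S.q ^ (wordExp l).2 : Rˣ)
    set f := ∑ i ∈ (Finset.range (α.fst + 1) ×ˢ Finset.range (α.snd + 1)).erase (α.fst, α.snd),
      S.L i.1 i.2 * S.coeff α.fst α.snd i with hf
    have hfF : f ∈ S.F (α.deg - 1) := by
      refine sum_mem fun i hi => S.mul_mem_F_right (S.F_mono ?_ (S.L_mem_F _ _))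
        (S.coeff_mem_C _ _ _)
      have := lt_of_mem_erase hi
      unfold YIndex.deg
      omega
    have e2 : S.wordY (α :: l) - S.wordL (α :: l) *
        ((u * S.monomialUnit α.fst α.snd : Rˣ) : R) =
        S.L α.fst α.snd * (S.wordY l - S.wordL l * u) * S.monomialUnit α.fst α.snd +
          f * S.wordY l := by
      rw [wordY_cons, Y_eq_add_sum, ← hf, add_mul, mul_assoc (S.L _ _),
        ← (S.commute_wordY_C l (S.monomialUnit_mem_C α.fst α.snd)).eq]
      simp only [wordL, List.map_cons, List.prod_cons, Units.val_mul, mul_sub, sub_mul, mul_assoc]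
      abel
    rw [e1, e2]
    refine add_mem (S.mul_mem_F_right ?_ (S.monomialUnit_mem_C _ _)) ?_
    · refine S.mul_mem_F ?_ (S.L_mem_F _ _) ih
      rw [wordDeg_cons, YIndex.deg]
      omega
    · refine S.mul_mem_F ?_ hfF (S.wordY_mem_F le_rfl)
      rw [wordDeg_cons]
      omega

/-- If the ordered monomials in `L_α, d₁, d₂, ∂₁^{±1}, ∂₂^{±1}` are linearly independent, then so
are the ordered monomials in the `Y_α`. -/
theorem linearIndependent_wordY [LinearOrder YIndex]
    (h : LinearIndependent ℂ fun x : Multiset YIndex × ((ℕ × ℕ) × (ℤ × ℤ)) =>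
      S.wordL x.1.sort * S.cMonomial x.2) :
    LinearIndependent ℂ fun s : Multiset YIndex => S.wordY s.sort := by
  classical
  have hlead : ∀ s : Multiset YIndex,
      S.wordL s.sort * ((S.p ^ (wordExp s.sort).1 * S.q ^ (wordExp s.sort).2 : Rˣ) : R) =
        S.wordL s.sort * S.cMonomial ((0, 0), wordExp s.sort) := fun s => by simp [cMonomial]
  rw [linearIndependent_iff]
  intro g hg
  by_contra hne
  obtain ⟨s₀, hs₀, hmax⟩ := g.support.exists_max_image
    (fun s : Multiset YIndex => wordDeg (s.sort (· ≤ ·)))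
    (Finsupp.support_nonempty_iff.2 hne)
  -- The coordinate of the leading monomial of `s₀`, extended from the span of the ordered monomials
  -- to `R`.
  have hform : ∃ φ : R →ₗ[ℂ] ℂ, ∀ x, φ (S.wordL x.1.sort * S.cMonomial x.2) =
      if x = (s₀, ((0, 0), wordExp s₀.sort)) then 1 else 0 := by
    obtain ⟨φ, hφ⟩ := LinearMap.exists_extend
      ((Finsupp.lapply (s₀, ((0, 0), wordExp s₀.sort))) ∘ₗ h.repr)
    refine ⟨φ, fun x => ?_⟩
    have hx := LinearMap.congr_fun hφ ⟨_, Submodule.subset_span ⟨x, rfl⟩⟩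
    simp only [LinearMap.comp_apply, Submodule.subtype_apply] at hx
    rw [hx, h.repr_eq_single x _ rfl, Finsupp.lapply_apply,
      Finsupp.single_apply]
  obtain ⟨φ, hφ⟩ := hform
  -- A word of degree below that of `s₀` belongs to a different multiset. Modulo lower terms, its
  -- products with `C` involve only ordered monomials on which `φ` vanishes.
  have hker : ∀ n < wordDeg s₀.sort, S.F n ≤ LinearMap.ker φ := by
    intro n hn
    refine S.F_le fun s c hs hc hF => ?_
    have e : S.wordY s.sort * c = (S.wordY s.sort -
        S.wordL s.sort * ((S.p ^ (wordExp s.sort).1 * S.q ^ (wordExp s.sort).2 : Rˣ) : R)) * c +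
        S.wordL s.sort *
          (((S.p ^ (wordExp s.sort).1 * S.q ^ (wordExp s.sort).2 : Rˣ) : R) * c) := by
      rw [sub_mul, mul_assoc (S.wordL _), sub_add_cancel]
    rw [e]
    refine add_mem (hF (S.mul_mem_F_right (S.wordY_sub_wordL_mem_F _) hc)) ?_
    have hc' : ((S.p ^ (wordExp s.sort).1 * S.q ^ (wordExp s.sort).2 : Rˣ) : R) * c ∈ S.C := by
      rw [Units.val_mul]
      exact mul_mem (mul_mem (S.p_zpow_mem_C _) (S.q_zpow_mem_C _)) hc
    have hmem := S.mem_span_cMonomial hc'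
    generalize ((S.p ^ (wordExp s.sort).1 * S.q ^ (wordExp s.sort).2 : Rˣ) : R) * c = u at hmem
    clear hc' e
    induction hmem using Submodule.span_induction with
    | mem _ hx =>
      obtain ⟨x, rfl⟩ := hx
      rw [LinearMap.mem_ker, hφ (s, x), if_neg]
      rintro h0
      rw [(Prod.mk.inj h0).1] at hs
      omega
    | zero => simp
    | add u v _ _ hu hv => rw [mul_add]; exact add_mem hu hv
    | smul c u _ hu => rw [mul_smul_comm]; exact Submodule.smul_mem _ _ hu
  have hval : ∀ s, wordDeg s.sort ≤ wordDeg s₀.sort →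
      φ (S.wordY s.sort) = if s = s₀ then 1 else 0 := by
    intro s hs
    have h1 := hker (wordDeg s.sort - 1) (by omega) (S.wordY_sub_wordL_mem_F _)
    rw [LinearMap.mem_ker, map_sub, sub_eq_zero, hlead] at h1
    have h2 := hφ (s, ((0, 0), wordExp s.sort))
    rw [h1, h2]
    by_cases h3 : s = s₀
    · subst h3; simp
    · rw [if_neg h3, if_neg]
      exact fun h0 => h3 (Prod.mk.inj h0).1
  have h0 := congrArg φ hg
  rw [Finsupp.linearCombination_apply, Finsupp.sum, map_sum, map_zero,
    Finset.sum_eq_single_of_mem s₀ hs₀] at h0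
  · rw [map_smul, hval s₀ le_rfl, if_pos rfl, smul_eq_mul, mul_one] at h0
    exact Finsupp.mem_support_iff.1 hs₀ h0
  · intro s hs hne
    rw [map_smul, hval s (hmax s hs), if_neg hne, smul_zero]

end SBarSystem

open MvPolynomial

/-! ### Hamiltonian vector fields -/

/-- The Hamiltonian vector field `∂₂(f) ∂₁ - ∂₁(f) ∂₂`. -/
def hamiltonian : A2 →ₗ[ℂ] W2 where
  toFun f := pderiv 1 f • (pderiv 0 : W2) - pderiv 0 f • (pderiv 1 : W2)
  map_add' f g := by simp only [map_add, add_smul]; abel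
  map_smul' c f := by
    simp only [Derivation.map_smul, smul_assoc, smul_sub, RingHom.id_apply]

theorem hamiltonian_apply (f g : A2) :
    hamiltonian f g = pderiv 1 f * pderiv 0 g - pderiv 0 f * pderiv 1 g := by
  simp [hamiltonian]

theorem hamiltonian_X_zero (f : A2) : hamiltonian f (X 0) = pderiv 1 f := by
  simp [hamiltonian_apply, pderiv_X]

theorem hamiltonian_X_one (f : A2) : hamiltonian f (X 1) = -pderiv 0 f := by
  simp [hamiltonian_apply, pderiv_X]

theorem W2_ext {D E : W2} (h0 : D (X 0) = E (X 0)) (h1 : D (X 1) = E (X 1)) : D = E := by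
  apply MvPolynomial.derivation_ext
  intro i
  fin_cases i
  exacts [h0, h1]

theorem lie_hamiltonian (f g : A2) : ⁅hamiltonian f, hamiltonian g⁆ =
    hamiltonian (pderiv 1 f * pderiv 0 g - pderiv 0 f * pderiv 1 g) := by
  apply W2_ext
  · rw [Derivation.commutator_apply, hamiltonian_X_zero, hamiltonian_X_zero, hamiltonian_X_zero,
      hamiltonian_apply, hamiltonian_apply]
    simp only [map_sub, Derivation.leibniz, smul_eq_mul]
    rw [pderiv_comm 1 0 f, pderiv_comm 1 0 g]
    ring
  · rw [Derivation.commutator_apply, hamiltonian_X_one, hamiltonian_X_one, hamiltonian_X_one,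
      hamiltonian_apply, hamiltonian_apply]
    simp only [map_sub, map_neg, Derivation.leibniz, smul_eq_mul]
    rw [pderiv_comm 1 0 f, pderiv_comm 1 0 g]
    ring

theorem lie_pderiv_hamiltonian (i : Fin 2) (f : A2) :
    ⁅(pderiv i : W2), hamiltonian f⁆ = hamiltonian (pderiv i f) := by
  apply W2_ext
  · simp only [Derivation.commutator_apply, hamiltonian_X_zero, pderiv_comm i 1]
    fin_cases i <;> simp [pderiv_X]
  · simp only [Derivation.commutator_apply, hamiltonian_X_one, map_neg, pderiv_comm i 0]
    fin_cases i <;> simp [pderiv_X]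

/-- The term -f appears because t_i ∂_i has divergence one and so rescales the area form. It is the
source of the weights j - 1 and k - 1. -/
theorem lie_euler_hamiltonian (i : Fin 2) (f : A2) :
    ⁅(X i : A2) • (pderiv i : W2), hamiltonian f⁆ = hamiltonian (X i * pderiv i f - f) := by
  apply W2_ext <;> fin_cases i <;>
  · simp [Derivation.commutator_apply, hamiltonian_apply, pderiv_X, pderiv_comm 1 0 f]

theorem divergence_hamiltonian (f : A2) : divergence (hamiltonian f) = 0 := by
  simp [divergence, hamiltonian_apply, pderiv_X, pderiv_comm 1 0 f]

/-- The Hamiltonian vector field of `f` as an element of `S̄₂`. -/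
def hamS : A2 →ₗ[ℂ] SBar where
  toFun f := ⟨hamiltonian f, 0, by rw [divergence_hamiltonian, map_zero]⟩
  map_add' f g := Subtype.ext (map_add hamiltonian f g)
  map_smul' c f := Subtype.ext (map_smul hamiltonian c f)

theorem coe_hamS (f : A2) : (hamS f : W2) = hamiltonian f := rfl

theorem lie_hamS (f g : A2) :
    ⁅hamS f, hamS g⁆ = hamS (pderiv 1 f * pderiv 0 g - pderiv 0 f * pderiv 1 g) :=
  Subtype.ext (lie_hamiltonian f g)

theorem lie_partialS_hamS (i : Fin 2) (f : A2) : ⁅partialS i, hamS f⁆ = hamS (pderiv i f) :=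
  Subtype.ext (lie_pderiv_hamiltonian i f)

theorem lie_eulerS_hamS (i : Fin 2) (f : A2) :
    ⁅eulerS i, hamS f⁆ = hamS (X i * pderiv i f - f) :=
  Subtype.ext (lie_euler_hamiltonian i f)

theorem lie_partialS_eulerS (i j : Fin 2) :
    ⁅partialS i, eulerS j⁆ = if i = j then partialS i else 0 := by
  apply Subtype.ext
  change ⁅(pderiv i : W2), (X j : A2) • (pderiv j : W2)⁆ = _
  apply W2_ext <;> fin_cases i <;> fin_cases j <;>
    simp [Derivation.commutator_apply, partialS, pderiv_X]

theorem lie_eulerS (i j : Fin 2) : ⁅eulerS i, eulerS j⁆ = 0 := by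
  apply Subtype.ext
  change ⁅(X i : A2) • (pderiv i : W2), (X j : A2) • (pderiv j : W2)⁆ = 0
  apply W2_ext <;> fin_cases i <;> fin_cases j <;>
    simp [Derivation.commutator_apply, pderiv_X]

/-- The monomial `t₁^j t₂^k`. -/
def mon (j k : ℕ) : A2 := X 0 ^ j * X 1 ^ k

theorem pderiv_zero_mon (j k : ℕ) : pderiv 0 (mon j k) = (j : ℂ) • mon (j - 1) k := by
  simp [mon, pderiv_X, MvPolynomial.smul_eq_C_mul]
  ring

theorem pderiv_one_mon (j k : ℕ) : pderiv 1 (mon j k) = (k : ℂ) • mon j (k - 1) := by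
  simp [mon, pderiv_X, MvPolynomial.smul_eq_C_mul]
  ring

theorem X_zero_mul_pderiv_mon (j k : ℕ) :
    X 0 * pderiv 0 (mon j k) - mon j k = ((j : ℂ) - 1) • mon j k := by
  rw [pderiv_zero_mon, sub_smul, one_smul, mul_smul_comm]
  cases j with
  | zero => simp
  | succ j => simp only [mon, Nat.add_sub_cancel]; congr 2; ring

theorem X_one_mul_pderiv_mon (j k : ℕ) :
    X 1 * pderiv 1 (mon j k) - mon j k = ((k : ℂ) - 1) • mon j k := by
  rw [pderiv_one_mon, sub_smul, one_smul, mul_smul_comm]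
  cases k with
  | zero => simp
  | succ j => simp only [mon, Nat.add_sub_cancel]; congr 2; ring

theorem poisson_mon (j k j' k' : ℕ) :
    pderiv 1 (mon j k) * pderiv 0 (mon j' k') - pderiv 0 (mon j k) * pderiv 1 (mon j' k') =
      ((k : ℂ) * j' - j * k') • mon (j + j' - 1) (k + k' - 1) := by
  -- The scalar is kept so that the exponent law also holds for j' = 0, where truncated subtraction
  -- would break it.
  have h1 : ∀ j j' : ℕ, (j' : ℂ) • (X 0 ^ j * X 0 ^ (j' - 1) : A2) =
      (j' : ℂ) • (X 0 : A2) ^ (j + j' - 1) := by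
    intro j j'
    cases j' with
    | zero => simp
    | succ n => rw [← pow_add]; rfl
  have h2 : ∀ k k' : ℕ, (k : ℂ) • (X 1 ^ (k - 1) * X 1 ^ k' : A2) =
      (k : ℂ) • (X 1 : A2) ^ (k + k' - 1) := by
    intro k k'
    cases k with
    | zero => simp
    | succ n => rw [← pow_add]; congr 2; omega
  have e1 : ((k : ℂ) • mon j (k - 1)) * ((j' : ℂ) • mon (j' - 1) k') =
      ((j' : ℂ) • (X 0 ^ j * X 0 ^ (j' - 1) : A2)) *
        ((k : ℂ) • (X 1 ^ (k - 1) * X 1 ^ k' : A2)) := by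
    simp only [mon, MvPolynomial.smul_eq_C_mul]; ring
  have e2 : ((j : ℂ) • mon (j - 1) k) * ((k' : ℂ) • mon j' (k' - 1)) =
      ((j : ℂ) • (X 0 ^ j' * X 0 ^ (j - 1) : A2)) *
        ((k' : ℂ) • (X 1 ^ (k' - 1) * X 1 ^ k : A2)) := by
    simp only [mon, MvPolynomial.smul_eq_C_mul]; ring
  rw [pderiv_one_mon, pderiv_zero_mon, pderiv_one_mon, pderiv_zero_mon, e1, e2, h1, h1, h2, h2,
    add_comm j' j, add_comm k' k]
  simp only [mon, MvPolynomial.smul_eq_C_mul, map_sub, map_mul]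
  ring

theorem genL_eq (j k : ℕ) : genL ((j : ℤ) - 1, (k : ℤ) - 1) = hamS (mon j k) := by
  rw [genL, dif_pos (by simp only; omega)]
  apply Subtype.ext
  have e2 : ∀ k : ℕ, ((k : ℤ) - 1).toNat = k - 1 := fun k => by omega
  apply W2_ext
  · rw [coe_hamS, hamiltonian_X_zero, pderiv_one_mon]
    simp [derivationL, pderiv_X, e2, mon]
  · rw [coe_hamS, hamiltonian_X_one, pderiv_zero_mon]
    simp [derivationL, pderiv_X, e2, mon]

theorem hamS_mon_zero_zero : hamS (mon 0 0) = 0 := by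
  apply Subtype.ext
  apply W2_ext <;> simp [coe_hamS, hamiltonian_apply, mon]

theorem hamS_mon_zero_one : hamS (mon 0 1) = partialS 0 := by
  apply Subtype.ext
  apply W2_ext <;> simp [coe_hamS, hamiltonian_apply, mon, partialS, pderiv_X]

theorem hamS_mon_one_zero : hamS (mon 1 0) = -partialS 1 := by
  apply Subtype.ext
  apply W2_ext <;> simp [coe_hamS, hamiltonian_apply, mon, partialS, pderiv_X]

theorem hamS_mon_one_one : hamS (mon 1 1) = eulerS 0 - eulerS 1 := by
  apply Subtype.ext
  apply W2_ext <;> simp [coe_hamS, hamiltonian_apply, mon, eulerS, pderiv_X]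

/-! ### Spanning of `S̄₂` -/

/-- Termwise integration with respect to the variable `i`. -/
def integral (i : Fin 2) : A2 →ₗ[ℂ] A2 :=
  (basisMonomials (Fin 2) ℂ).constr ℂ fun s => monomial (s + Finsupp.single i 1) ((s i : ℂ) + 1)⁻¹

theorem integral_monomial (i : Fin 2) (s : Fin 2 →₀ ℕ) (a : ℂ) :
    integral i (monomial s a) = monomial (s + Finsupp.single i 1) (a * ((s i : ℂ) + 1)⁻¹) := by
  have h := (basisMonomials (Fin 2) ℂ).constr_basis ℂ
    (fun s => (monomial (s + Finsupp.single i 1) ((s i : ℂ) + 1)⁻¹ : A2)) s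
  rw [coe_basisMonomials] at h
  have e : (monomial s a : A2) = a • monomial s 1 := by rw [smul_monomial, smul_eq_mul, mul_one]
  rw [e, map_smul, integral, h, smul_monomial, smul_eq_mul]

theorem pderiv_integral (i : Fin 2) (f : A2) : pderiv i (integral i f) = f := by
  induction f using MvPolynomial.induction_on' with
  | monomial s a =>
    rw [integral_monomial, pderiv_monomial, add_tsub_cancel_right]
    congr 1
    simp only [Finsupp.add_apply, Finsupp.single_eq_same, Nat.cast_add, Nat.cast_one]
    exact inv_mul_cancel_right₀ (Nat.cast_add_one_ne_zero _) a
  | add f g hf hg => rw [map_add, map_add, hf, hg]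

theorem pderiv_integral_of_ne {i j : Fin 2} (h : i ≠ j) (f : A2) :
    pderiv j (integral i f) = integral i (pderiv j f) := by
  induction f using MvPolynomial.induction_on' with
  | monomial s a =>
    rw [integral_monomial, pderiv_monomial, pderiv_monomial, integral_monomial]
    have h1 : (s - Finsupp.single j 1 : Fin 2 →₀ ℕ) i = s i := by simp [h.symm]
    have h2 : (s + Finsupp.single i 1 : Fin 2 →₀ ℕ) j = s j := by simp [h]
    rw [h1, h2]
    by_cases h3 : s j = 0
    · simp [h3]
    · have h4 : Finsupp.single j 1 ≤ s := by
        rw [Finsupp.single_le_iff]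
        omega
      rw [tsub_add_eq_add_tsub h4]
      congr 1
      ring
  | add f g hf hg => simp only [map_add, hf, hg]

theorem exists_eq_euler_add_hamS (D : SBar) : ∃ (c : ℂ) (f : A2), D = c • eulerS 1 + hamS f := by
  obtain ⟨D, c, hc⟩ := D
  have h0 : divergence D = pderiv 0 (D (X 0)) + pderiv 1 (D (X 1)) := by simp [divergence]
  rw [h0] at hc
  obtain ⟨f, hfD⟩ : ∃ f, pderiv 1 f = D (X 0) := ⟨_, pderiv_integral 1 _⟩
  -- After subtracting c d₂ the field is divergence free and `f` accounts for its ∂₁-component. The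
  -- error `r` in the other component depends on t₁ only, so integrating it in t₁ corrects `f`
  -- without disturbing the first component.
  obtain ⟨r, hr⟩ : ∃ r, r = D (X 1) - c • X 1 + pderiv 0 f := ⟨_, rfl⟩
  have hr0 : pderiv 1 r = 0 := by
    rw [hr, map_add, map_sub, pderiv_comm 1 0, hfD, Derivation.map_smul, pderiv_X_self,
      MvPolynomial.smul_eq_C_mul, mul_one, ← hc]
    ring
  refine ⟨c, f - integral 0 r, Subtype.ext (W2_ext ?_ ?_)⟩
  · change D (X 0) = _
    have : (((c • eulerS 1 + hamS (f - integral 0 r) : SBar) : W2) : W2) (X 0) =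
        c • ((X 1 : A2) • pderiv 1 (X 0)) + hamiltonian (f - integral 0 r) (X 0) := rfl
    rw [this, hamiltonian_X_zero, map_sub, pderiv_integral_of_ne (by decide), hr0, hfD]
    simp [pderiv_X]
  · change D (X 1) = _
    have : (((c • eulerS 1 + hamS (f - integral 0 r) : SBar) : W2) : W2) (X 1) =
        c • ((X 1 : A2) • pderiv 1 (X 1)) + hamiltonian (f - integral 0 r) (X 1) := rfl
    rw [this, hamiltonian_X_one, map_sub, pderiv_integral, hr]
    simp only [pderiv_X_self, smul_eq_mul, mul_one]
    ring

theorem monomial_eq_mon (s : Fin 2 →₀ ℕ) (a : ℂ) : monomial s a = a • mon (s 0) (s 1) := by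
  rw [monomial_eq, MvPolynomial.smul_eq_C_mul, mon, Finsupp.prod_fintype _ _ (by simp),
    Fin.prod_univ_two]

/-! ### The localized enveloping algebra -/

/-- The localization map as a homomorphism of algebras. -/
def locHom : U →ₐ[ℂ] ULoc :=
  { (OreLocalization.numeratorRingHom : U →+* ULoc) with commutes' := fun _ => rfl }

theorem toULoc_eq (x : SBar) : toULoc x = locHom (toU x) := rfl

/-- The map `S̄₂ → U₍₋₁₎` as a linear map. -/
def toULocLinear : SBar →ₗ[ℂ] ULoc :=
  let _ : LieRing U := LieRing.ofAssociativeRing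
  locHom.toLinearMap ∘ₗ (UniversalEnvelopingAlgebra.ι ℂ : SBar →ₗ⁅ℂ⁆ U).toLinearMap

theorem toULocLinear_apply (x : SBar) : toULocLinear x = toULoc x := rfl

theorem toULoc_mul (x y : SBar) :
    toULoc x * toULoc y = toULoc y * toULoc x + toULoc ⁅x, y⁆ := by
  simp only [toULoc_eq, toU_lie, map_sub, map_mul]
  abel

theorem toULoc_commute {x y : SBar} (h : ⁅x, y⁆ = 0) : Commute (toULoc x) (toULoc y) := by
  rw [Commute, SemiconjBy, toULoc_mul, h, ← toULocLinear_apply 0, map_zero, add_zero]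

theorem toULoc_mul_of_lie {x y z : SBar} {c : ℂ} (h : ⁅x, y⁆ = c • z) :
    toULoc x * toULoc y = toULoc y * toULoc x + c • toULoc z := by
  rw [toULoc_mul, h, ← toULocLinear_apply (c • z), map_smul, toULocLinear_apply]

theorem coe_partialUnit (i : Fin 2) : (partialUnit i : ULoc) = toULoc (partialS i) := rfl

theorem lie_partialS (i j : Fin 2) : ⁅partialS i, partialS j⁆ = 0 := by
  apply Subtype.ext
  change ⁅(pderiv i : W2), (pderiv j : W2)⁆ = 0
  apply W2_ext <;> fin_cases i <;> fin_cases j <;> simp [Derivation.commutator_apply, pderiv_X]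

/-- The generators of `U₍₋₁₎` and their relations. -/
def locSystem : SBarSystem ULoc where
  p := partialUnit 0
  q := partialUnit 1
  d := dLoc 0
  e := dLoc 1
  L j k := toULoc (hamS (mon j k))
  pq := toULoc_commute (lie_partialS 0 1)
  pd := by
    have h := toULoc_mul (partialS 0) (eulerS 0)
    rwa [lie_partialS_eulerS, if_pos rfl] at h
  qe := by
    have h := toULoc_mul (partialS 1) (eulerS 1)
    rwa [lie_partialS_eulerS, if_pos rfl] at h
  pe := toULoc_commute (by rw [lie_partialS_eulerS, if_neg (by decide)])
  qd := toULoc_commute (by rw [lie_partialS_eulerS, if_neg (by decide)])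
  de := toULoc_commute (lie_eulerS 0 1)
  pL j k := toULoc_mul_of_lie (by rw [lie_partialS_hamS, pderiv_zero_mon, map_smul])
  qL j k := toULoc_mul_of_lie (by rw [lie_partialS_hamS, pderiv_one_mon, map_smul])
  dL j k := toULoc_mul_of_lie (by rw [lie_eulerS_hamS, X_zero_mul_pderiv_mon, map_smul])
  eL j k := toULoc_mul_of_lie (by rw [lie_eulerS_hamS, X_one_mul_pderiv_mon, map_smul])
  LL j k j' k' := by
    rw [sub_eq_iff_eq_add']
    exact toULoc_mul_of_lie (by rw [lie_hamS, poisson_mon, map_smul])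
  L_zero_zero := by rw [hamS_mon_zero_zero, ← toULocLinear_apply, map_zero]
  L_zero_one := by rw [hamS_mon_zero_one, coe_partialUnit]
  L_one_zero := by
    rw [hamS_mon_one_zero, ← toULocLinear_apply, map_neg, toULocLinear_apply, coe_partialUnit]
  L_one_one := by
    rw [hamS_mon_one_one, ← toULocLinear_apply, map_sub, toULocLinear_apply, toULocLinear_apply]
    rfl

theorem genL_eq_L (j k : ℕ) : toULoc (genL ((j : ℤ) - 1, (k : ℤ) - 1)) = locSystem.L j k := by
  rw [genL_eq]
  rfl

/-- S̄₂ is spanned by d₂ and Hamiltonian fields of monomials, so `A` contains the image of U(S̄₂);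
every fraction is s⁻¹ r with `s` a monomial in ∂₁, ∂₂. -/
theorem eq_top_of_L_mem (A : Subalgebra ℂ ULoc) (hC : locSystem.C ≤ A)
    (hL : ∀ j k, locSystem.L j k ∈ A) : A = ⊤ := by
  have hham : ∀ f : A2, toULoc (hamS f) ∈ A := by
    intro f
    induction f using MvPolynomial.induction_on' with
    | monomial s a =>
      rw [monomial_eq_mon, map_smul, ← toULocLinear_apply, map_smul]
      exact A.smul_mem (hL _ _) a
    | add f g hf hg =>
      rw [map_add, ← toULocLinear_apply, map_add]
      exact add_mem hf hg
  have hD : ∀ D : SBar, toULoc D ∈ A := by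
    intro D
    obtain ⟨c, f, rfl⟩ := exists_eq_euler_add_hamS D
    rw [← toULocLinear_apply, map_add, map_smul]
    exact add_mem (A.smul_mem (hC locSystem.e_mem_C) c) (hham f)
  have hU : ∀ u : U, locHom u ∈ A := by
    intro u
    obtain ⟨w, rfl⟩ : ∃ w, UniversalEnvelopingAlgebra.mkAlgHom ℂ SBar w = u :=
      RingCon.mkₐ_surjective _ u
    induction w using TensorAlgebra.induction with
    | algebraMap r =>
      rw [AlgHom.commutes, AlgHom.commutes]
      exact A.algebraMap_mem r
    | ι D => exact hD D
    | mul a b ha hb => rw [map_mul, map_mul]; exact mul_mem ha hb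
    | add a b ha hb => rw [map_add, map_add]; exact add_mem ha hb
  refine eq_top_iff.2 fun x _ => ?_
  induction x using OreLocalization.ind with
  | _ r s =>
    obtain ⟨_, i, j, rfl⟩ := s
    set s : partialMonoid := ⟨toU (partialS 0) ^ i * toU (partialS 1) ^ j, i, j, rfl⟩ with hs
    have h1 : (OreLocalization.numeratorUnit s : ULocˣ) =
        partialUnit 0 ^ i * partialUnit 1 ^ j := by
      apply Units.ext
      rw [Units.val_mul, Units.val_pow_eq_pow_val, Units.val_pow_eq_pow_val, coe_partialUnit,
        coe_partialUnit, toULoc_eq, toULoc_eq, ← map_pow, ← map_pow, ← map_mul]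
      rfl
    have h2 : (OreLocalization.oreDiv r s : ULoc) =
        ((OreLocalization.numeratorUnit s : ULocˣ)⁻¹ : ULocˣ) * locHom r := by
      rw [Units.eq_inv_mul_iff_mul_eq]
      change OreLocalization.oreDiv (s : U) (1 : partialMonoid) * OreLocalization.oreDiv r s =
        OreLocalization.oreDiv r (1 : partialMonoid)
      rw [OreLocalization.mul_cancel]
    rw [h2, h1, mul_inv_rev, ← inv_pow, ← inv_pow, Units.val_mul, Units.val_pow_eq_pow_val,
      Units.val_pow_eq_pow_val]
    exact mul_mem (mul_mem (pow_mem (hC locSystem.q_inv_mem_C) j)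
      (pow_mem (hC locSystem.p_inv_mem_C) i)) (hU r)

/-- If x r = 0 then [x, r] = -r x, so iterated commutators with `x` are, up to sign, the products r
xⁿ. -/
theorem mul_pow_eq_zero_of_mul_eq_zero {R : Type*} [Ring R] (x : R) (n : ℕ) (r : R)
    (h : (fun v : R => x * v - v * x)^[n] r = 0) (h0 : x * r = 0) : r * x ^ n = 0 := by
  induction n generalizing r with
  | zero => simpa using h
  | succ n ih =>
    have := ih (x * r - r * x) (by simpa using h) (by
      rw [mul_sub, h0, ← mul_assoc, h0]; simp)
    rw [h0, zero_sub, neg_mul, neg_eq_zero] at this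
    rw [pow_succ', ← mul_assoc, this]

theorem exists_mul_pow_eq_zero {R : Type*} [Ring R] (x : R)
    (hx : ∀ r, ∃ n : ℕ, (fun v : R => x * v - v * x)^[n] r = 0) (i : ℕ) (r : R)
    (h : x ^ i * r = 0) : ∃ n : ℕ, r * x ^ n = 0 := by
  induction i generalizing r with
  | zero => exact ⟨0, by simpa using h⟩
  | succ i ih =>
    obtain ⟨n, hn⟩ := ih (x * r) (by rw [← mul_assoc, ← pow_succ, h])
    obtain ⟨m, hm⟩ := hx (r * x ^ n)
    refine ⟨n + m, ?_⟩
    rw [pow_add, ← mul_assoc]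
    exact mul_pow_eq_zero_of_mul_eq_zero x m _ hm (by rw [← mul_assoc, hn])

/-- The Ore construction gives annihilation from the left; local nilpotency moves the monomial to
the right, where it merely raises exponents in the ordered monomials. -/
theorem exists_mul_eq_zero_of_locHom_eq_zero {u : U} (h : locHom u = 0) :
    ∃ m n : ℕ, u * (toU (partialS 0) ^ m * toU (partialS 1) ^ n) = 0 := by
  have h' : OreLocalization.oreDiv (0 : U) (1 : partialMonoid) =
      OreLocalization.oreDiv u (1 : partialMonoid) := by
    rw [OreLocalization.zero_oreDiv]
    exact h.symm
  rw [OreLocalization.oreDiv_eq_iff] at h'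
  obtain ⟨⟨_, i, j, rfl⟩, v, h1, -⟩ := h'
  have h2 : toU (partialS 0) ^ i * (toU (partialS 1) ^ j * u) = 0 := by
    rw [smul_zero] at h1
    rw [← mul_assoc]
    exact h1
  obtain ⟨m, hm⟩ := exists_mul_pow_eq_zero _ (commutator_nilpotent 0) i _ h2
  rw [mul_assoc] at hm
  obtain ⟨n, hn⟩ := exists_mul_pow_eq_zero _ (commutator_nilpotent 1) j _ hm
  exact ⟨m, n, by rw [← mul_assoc, hn]⟩

/-! ### Linear independence of the ordered monomials in `U₍₋₁₎` -/

/-- The index set of the basis `L_α, d_i, ∂_i` of `S̄₂`. -/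
abbrev SIndex : Type := YIndex ⊕ (Fin 2 ⊕ Fin 2)

/-- The basis `L_α, d_i, ∂_i` of `S̄₂`. -/
def basisElt : SIndex → SBar
  | Sum.inl α => hamS (mon α.fst α.snd)
  | Sum.inr (Sum.inl i) => eulerS i
  | Sum.inr (Sum.inr i) => partialS i

section

attribute [local instance] LieRing.ofAssociativeRing

/-- The action of `S̄₂` on polynomials. -/
def polyRep : SBar →ₗ⁅ℂ⁆ Module.End ℂ A2 where
  toFun D := ((D : W2) : A2 →ₗ[ℂ] A2)
  map_add' _ _ := rfl
  map_smul' _ _ := rfl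
  map_lie' := rfl

end

/-- The linear form `T ↦ c (T(tᵥ)_s - (tᵥ)_s T(1)_0)` on endomorphisms, where `f_s` is the
coefficient of `t^s` in `f`. -/
def coeffForm (v : Fin 2) (s : Fin 2 →₀ ℕ) (c : ℂ) : Module.End ℂ A2 →ₗ[ℂ] ℂ :=
  c • ((lcoeff ℂ s ∘ₗ LinearMap.applyₗ (X v : A2)) -
    coeff s (X v : A2) • (lcoeff ℂ 0 ∘ₗ LinearMap.applyₗ (1 : A2)))

/-- `linearIndependent_wordProd` needs forms that kill the identity. The correction term ensures
this and is invisible on derivations, as they kill `1`. -/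
theorem coeffForm_one (v : Fin 2) (s : Fin 2 →₀ ℕ) (c : ℂ) : coeffForm v s c 1 = 0 := by
  simp [coeffForm]

theorem coeffForm_polyRep (v : Fin 2) (s : Fin 2 →₀ ℕ) (c : ℂ) (D : SBar) :
    coeffForm v s c (polyRep D) = c * coeff s ((D : W2) (X v)) := by
  have h1 : polyRep D (1 : A2) = 0 := (D : W2).map_one_eq_zero
  have h2 : polyRep D (X v : A2) = (D : W2) (X v) := rfl
  simp [coeffForm, h1, h2]

/-- The exponent of `t₁^j t₂^k`. -/
def expo (j k : ℕ) : Fin 2 →₀ ℕ := Finsupp.single 0 j + Finsupp.single 1 k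

theorem expo_inj {j k j' k' : ℕ} : expo j k = expo j' k' ↔ j = j' ∧ k = k' := by
  constructor
  · intro h
    have h0 := DFunLike.congr_fun h 0
    have h1 := DFunLike.congr_fun h 1
    simp only [expo, Finsupp.add_apply, Finsupp.single_apply] at h0 h1
    simpa using And.intro h0 h1
  · rintro ⟨rfl, rfl⟩
    rfl

theorem coeff_expo_mon (j k j' k' : ℕ) :
    coeff (expo j k) (mon j' k') = if j' = j ∧ k' = k then 1 else 0 := by
  have h : mon j' k' = monomial (expo j' k') 1 := by
    rw [monomial_eq_mon, one_smul]
    simp [expo]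
  rw [h, coeff_monomial]
  simp only [expo_inj]

/-- The dual linear forms of the basis of `S̄₂`. -/
def dualForm : SIndex → Module.End ℂ A2 →ₗ[ℂ] ℂ
  -- When `α.snd = 0` the field L_α has no ∂₁-component and is detected on t₂, otherwise on t₁; the
  -- inverse factors undo the differentiation of the Hamiltonian.
  | Sum.inl α => if α.snd = 0 then coeffForm 1 (expo (α.fst - 1) 0) (-(α.fst : ℂ)⁻¹)
      else coeffForm 0 (expo α.fst (α.snd - 1)) (α.snd : ℂ)⁻¹
  | Sum.inr (Sum.inl i) => coeffForm i (if i = 0 then expo 1 0 else expo 0 1) 1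
  | Sum.inr (Sum.inr i) => coeffForm i (expo 0 0) 1

theorem YIndex.two_le (α : YIndex) : 2 ≤ α.fst + α.snd := by
  have := α.coe_fst
  have := α.coe_snd
  have := α.2.2.2.1
  omega

theorem YIndex.ne_one (α : YIndex) : ¬ (α.fst = 1 ∧ α.snd = 1) := by
  intro h
  have h1 := α.coe_fst
  have h2 := α.coe_snd
  refine α.2.2.2.2 (Prod.ext ?_ ?_)
  · simp only [Prod.fst_zero]; omega
  · simp only [Prod.snd_zero]; omega

theorem eulerS_apply_X (i v : Fin 2) : (eulerS i : W2) (X v) =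
    if i = v then (if v = 0 then mon 1 0 else mon 0 1) else 0 := by
  fin_cases i <;> fin_cases v <;> simp [eulerS, pderiv_X, mon]

theorem partialS_apply_X (i v : Fin 2) : (partialS i : W2) (X v) =
    if i = v then mon 0 0 else 0 := by
  fin_cases i <;> fin_cases v <;> simp [partialS, pderiv_X, mon]

theorem hamS_mon_apply_X_zero (j k : ℕ) :
    (hamS (mon j k) : W2) (X 0) = (k : ℂ) • mon j (k - 1) := by
  rw [coe_hamS, hamiltonian_X_zero, pderiv_one_mon]

theorem hamS_mon_apply_X_one (j k : ℕ) :
    (hamS (mon j k) : W2) (X 1) = -((j : ℂ) • mon (j - 1) k) := by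
  rw [coe_hamS, hamiltonian_X_one, pderiv_zero_mon]

/-- The constraints on `YIndex` are what separates L_α from d_i and ∂_i: the coefficients read for
d_i meet a Hamiltonian monomial only at (1, 1), those for ∂_i only at total exponent one. -/
theorem dualForm_basisElt [DecidableEq SIndex] (i j : SIndex) :
    dualForm i (polyRep (basisElt j)) = if i = j then 1 else 0 := by
  rcases i with α | i | i
  · have h2 := α.two_le
    have h1 := α.ne_one
    by_cases h0 : α.snd = 0
    · simp only [dualForm, if_pos h0, coeffForm_polyRep]
      rcases j with β | j | j
      · have hα : (α.fst : ℂ) ≠ 0 := Nat.cast_ne_zero.2 (by omega)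
        simp only [basisElt, hamS_mon_apply_X_one, coeff_neg, coeff_smul, coeff_expo_mon]
        by_cases hβ : α = β
        · subst hβ
          simp [h0, hα]
        · rw [if_neg (c := Sum.inl α = Sum.inl β) (fun h => hβ (Sum.inl.inj h))]
          by_cases h3 : β.fst = 0
          · simp [h3]
          · rw [if_neg]
            · simp
            · rintro ⟨h4, h5⟩
              exact hβ (YIndex.ext' (by omega) (by omega))
      · simp only [basisElt, eulerS_apply_X]
        fin_cases j <;> simp [coeff_expo_mon]
      · simp only [basisElt, partialS_apply_X]
        fin_cases j <;> simp [coeff_expo_mon]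
        omega
    · simp only [dualForm, if_neg h0, coeffForm_polyRep]
      rcases j with β | j | j
      · have hα : (α.snd : ℂ) ≠ 0 := Nat.cast_ne_zero.2 h0
        simp only [basisElt, hamS_mon_apply_X_zero, coeff_smul, coeff_expo_mon]
        by_cases hβ : α = β
        · subst hβ
          simp [hα]
        · rw [if_neg (c := Sum.inl α = Sum.inl β) (fun h => hβ (Sum.inl.inj h))]
          by_cases h3 : β.snd = 0
          · simp [h3]
          · rw [if_neg]
            · simp
            · rintro ⟨h4, h5⟩
              exact hβ (YIndex.ext' (by omega) (by omega))
      · simp only [basisElt, eulerS_apply_X]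
        fin_cases j <;> simp [coeff_expo_mon]
        omega
      · simp only [basisElt, partialS_apply_X]
        fin_cases j <;> simp [coeff_expo_mon]
        omega
  · simp only [dualForm, coeffForm_polyRep]
    rcases j with β | j | j
    · have h2 := β.two_le
      have h1 := β.ne_one
      fin_cases i <;>
        simp [basisElt, hamS_mon_apply_X_zero, hamS_mon_apply_X_one, coeff_expo_mon] <;> omega
    · fin_cases i <;> fin_cases j <;> simp [basisElt, eulerS_apply_X, coeff_expo_mon]
    · fin_cases i <;> fin_cases j <;> simp [basisElt, partialS_apply_X, coeff_expo_mon]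
  · simp only [dualForm, coeffForm_polyRep]
    rcases j with β | j | j
    · have h2 := β.two_le
      have h1 := β.ne_one
      fin_cases i <;>
        simp [basisElt, hamS_mon_apply_X_zero, hamS_mon_apply_X_one, coeff_expo_mon] <;> omega
    · fin_cases i <;> fin_cases j <;> simp [basisElt, eulerS_apply_X, coeff_expo_mon]
    · fin_cases i <;> fin_cases j <;> simp [basisElt, partialS_apply_X, coeff_expo_mon]

theorem dualForm_one (i : SIndex) : dualForm i 1 = 0 := by
  rcases i with α | i | i
  · by_cases h0 : α.snd = 0
    · rw [dualForm, if_pos h0, coeffForm_one]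
    · rw [dualForm, if_neg h0, coeffForm_one]
  · rw [dualForm, coeffForm_one]
  · rw [dualForm, coeffForm_one]

/-- The word of the monomial `L^s d₁^a d₂^b ∂₁^m ∂₂^n`. -/
def monWord [LinearOrder YIndex] (x : Multiset YIndex × ((ℕ × ℕ) × (ℕ × ℕ))) : List SIndex :=
  x.1.sort.map Sum.inl ++ (List.replicate x.2.1.1 (Sum.inr (Sum.inl 0)) ++
    (List.replicate x.2.1.2 (Sum.inr (Sum.inl 1)) ++
      (List.replicate x.2.2.1 (Sum.inr (Sum.inr 0)) ++
        List.replicate x.2.2.2 (Sum.inr (Sum.inr 1)))))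

theorem monWord_perm [LinearOrder YIndex] {x y : Multiset YIndex × ((ℕ × ℕ) × (ℕ × ℕ))}
    (h : (monWord x).Perm (monWord y)) : x = y := by
  obtain ⟨s, ⟨a, b⟩, m, n⟩ := x
  obtain ⟨s', ⟨a', b'⟩, m', n'⟩ := y
  have ha := h.countP_eq (Sum.elim (fun _ => false) (Sum.elim (· == 0) fun _ => false))
  have hb := h.countP_eq (Sum.elim (fun _ => false) (Sum.elim (· == 1) fun _ => false))
  have hm := h.countP_eq (Sum.elim (fun _ => false) (Sum.elim (fun _ => false) (· == 0)))
  have hn := h.countP_eq (Sum.elim (fun _ => false) (Sum.elim (fun _ => false) (· == 1)))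
  have hs := h.filterMap Sum.getLeft?
  simp [monWord, List.countP_append, List.countP_map, List.countP_replicate, Function.comp_def]
    at ha hb hm hn
  simp only [monWord, List.filterMap_append, List.filterMap_map, List.filterMap_replicate] at hs
  have hs' : s.sort.Perm s'.sort := by simpa [Function.comp_def] using hs
  rw [← Multiset.coe_eq_coe, Multiset.sort_eq, Multiset.sort_eq] at hs'
  subst hs' ha hb hm hn
  rfl

/-- The monomial `L^s d₁^a d₂^b ∂₁^m ∂₂^n` in `U(S̄₂)`. -/
def monU [LinearOrder YIndex] (x : Multiset YIndex × ((ℕ × ℕ) × (ℕ × ℕ))) : U :=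
  UniversalEnvelopingAlgebra.wordProd basisElt (monWord x)

theorem monU_eq [LinearOrder YIndex] (s : Multiset YIndex) (a b m n : ℕ) :
    monU (s, ((a, b), (m, n))) = (s.sort.map fun α => toU (hamS (mon α.fst α.snd))).prod *
      (toU (eulerS 0) ^ a * (toU (eulerS 1) ^ b *
        (toU (partialS 0) ^ m * toU (partialS 1) ^ n))) := by
  simp only [monU, monWord, UniversalEnvelopingAlgebra.wordProd, List.map_append, List.prod_append,
    List.map_replicate, List.prod_replicate, List.map_map]
  rfl

theorem monU_mul [LinearOrder YIndex] (s : Multiset YIndex) (a b m n k l : ℕ) :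
    monU (s, ((a, b), (m, n))) * (toU (partialS 0) ^ k * toU (partialS 1) ^ l) =
      monU (s, ((a, b), (m + k, n + l))) := by
  have h : Commute (toU (partialS 1) ^ n) (toU (partialS 0) ^ k) :=
    Commute.pow_pow (toU_partial_comm 1 0) n k
  rw [monU_eq, monU_eq, pow_add, pow_add]
  simp only [mul_assoc]
  rw [← mul_assoc (toU (partialS 1) ^ n), h.eq]
  simp only [mul_assoc]

theorem locHom_monU [LinearOrder YIndex] (s : Multiset YIndex) (a b m n : ℕ) :
    locHom (monU (s, ((a, b), (m, n)))) =
      locSystem.wordL s.sort * locSystem.cMonomial ((a, b), ((m : ℤ), (n : ℤ))) := by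
  rw [monU_eq, SBarSystem.cMonomial, SBarSystem.wordL]
  simp only [map_mul, map_pow, map_list_prod, List.map_map, zpow_natCast, Units.val_mul,
    Units.val_pow_eq_pow_val, mul_assoc]
  rfl

theorem cMonomial_mul (a b : ℕ) (m n k l : ℤ) :
    locSystem.cMonomial ((a, b), (m, n)) * ((locSystem.p ^ k * locSystem.q ^ l : ULocˣ) : ULoc) =
      locSystem.cMonomial ((a, b), (m + k, n + l)) := by
  have hpq := locSystem.pq.units_of_val
  have h1 : locSystem.p ^ (m + k) * locSystem.q ^ (n + l) =
      locSystem.p ^ m * locSystem.q ^ n * (locSystem.p ^ k * locSystem.q ^ l) := by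
    rw [zpow_add, zpow_add, mul_assoc, mul_assoc, ← mul_assoc (locSystem.p ^ k),
      (hpq.zpow_zpow k n).eq, mul_assoc]
  simp only [SBarSystem.cMonomial]
  rw [h1, Units.val_mul _ (locSystem.p ^ k * locSystem.q ^ l), mul_assoc]

theorem linearIndependent_wordL_cMonomial [LinearOrder YIndex] :
    LinearIndependent ℂ fun x : Multiset YIndex × ((ℕ × ℕ) × (ℤ × ℤ)) =>
      locSystem.wordL x.1.sort * locSystem.cMonomial x.2 := by
  have := Classical.decEq SIndex
  rw [linearIndependent_iff']
  intro t g hg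
  obtain ⟨N, hN⟩ : ∃ N : ℕ, ∀ x ∈ t, 0 ≤ x.2.2.1 + N ∧ 0 ≤ x.2.2.2 + N := by
    refine ⟨t.sup fun x => x.2.2.1.natAbs + x.2.2.2.natAbs, fun x hx => ?_⟩
    have := Finset.le_sup (f := fun x : Multiset YIndex × ((ℕ × ℕ) × (ℤ × ℤ)) =>
      x.2.2.1.natAbs + x.2.2.2.natAbs) hx
    omega
  -- Right multiplication by (∂₁ ∂₂)^N makes all exponents nonnegative; `k` and `l` leave room for
  -- the further monomial needed to descend from the localization to U(S̄₂).
  let shift : Multiset YIndex × ((ℕ × ℕ) × (ℤ × ℤ)) → ℕ → ℕ →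
      Multiset YIndex × ((ℕ × ℕ) × (ℕ × ℕ)) := fun x k l =>
    (x.1, (x.2.1, ((x.2.2.1 + N).toNat + k, (x.2.2.2 + N).toNat + l)))
  have hloc : locHom (∑ x ∈ t, g x • monU (shift x 0 0)) = 0 := by
    have h := congrArg (· * ((locSystem.p ^ (N : ℤ) * locSystem.q ^ (N : ℤ) : ULocˣ) : ULoc)) hg
    simp only [zero_mul, Finset.sum_mul] at h
    rw [map_sum, ← h]
    refine Finset.sum_congr rfl fun x hx => ?_
    obtain ⟨s, ⟨a, b⟩, m, n⟩ := x
    have hx := hN _ hx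
    simp only at hx
    rw [map_smul, smul_mul_assoc, mul_assoc, cMonomial_mul, locHom_monU]
    simp only [add_zero, Int.toNat_of_nonneg hx.1, Int.toNat_of_nonneg hx.2]
  obtain ⟨k, l, hkl⟩ := exists_mul_eq_zero_of_locHom_eq_zero hloc
  have hsum : ∑ x : t, g x • monU (shift x k l) = 0 := by
    rw [Finset.sum_coe_sort t fun x => g x • monU (shift x k l), ← hkl, Finset.sum_mul]
    refine Finset.sum_congr rfl fun x _ => ?_
    obtain ⟨s, ⟨a, b⟩, m, n⟩ := x
    rw [smul_mul_assoc, monU_mul]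
    rfl
  have hind : LinearIndependent ℂ fun x : t => monU (shift x k l) := by
    refine UniversalEnvelopingAlgebra.linearIndependent_wordProd polyRep basisElt dualForm
      dualForm_one dualForm_basisElt (fun x : t => monWord (shift x k l)) ?_
    rintro ⟨⟨s, ab, m, n⟩, hx⟩ ⟨⟨s', ab', m', n'⟩, hy⟩ hp
    have h := monWord_perm hp
    have hx := hN _ hx
    have hy := hN _ hy
    simp only [shift, Prod.mk.injEq] at h hx hy
    obtain ⟨rfl, rfl, h1, h2⟩ := h
    have h3 : m = m' := by omega
    have h4 : n = n' := by omega
    subst h3 h4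
    rfl
  intro x hx
  exact Fintype.linearIndependent_iff.1 hind (fun x => g x) hsum ⟨x, hx⟩

/-! ### The elements `Y_α` -/

theorem falling_add_one {R : Type*} [Ring R] (x : R) (n : ℕ) :
    falling (x + 1) (n + 1) = (x + 1) * falling x n := by
  induction n with
  | zero => simp [falling]
  | succ n ih =>
    rw [falling, ih, falling, mul_assoc]
    have h1 : x + 1 - ((n + 1 : ℕ) : R) = x - n := by
      push_cast
      abel
    rw [h1]

theorem mul_falling_eq {R : Type*} [Ring R] {p d : R} (h : p * d = d * p + p) (n : ℕ) :
    p * falling d n = falling (d + 1) n * p := by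
  induction n with
  | zero => simp [falling]
  | succ n ih =>
    have h1 : p * (d - n) = (d + 1 - n) * p := by
      rw [mul_sub, h, (Nat.cast_commute n p).symm.eq, sub_mul, add_mul, one_mul]
    rw [falling, falling, ← mul_assoc, ih, mul_assoc, h1, mul_assoc]

theorem shiftProd_eq (x : ULoc) (lo hi : ℤ) :
    shiftProd x lo hi = falling (x - (lo : ULoc)) (hi + 1 - lo).toNat := by
  unfold shiftProd
  generalize (hi + 1 - lo).toNat = n
  induction n with
  | zero => simp [falling]
  | succ n ih =>
    rw [List.range_succ, List.map_append, List.prod_append, ih, falling]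
    simp [sub_sub]

theorem shiftProd_zero {x : ULoc} {hi : ℤ} {n : ℕ} (h : (hi + 1).toNat = n) :
    shiftProd x 0 hi = falling x n := by
  rw [shiftProd_eq, sub_zero, h, Int.cast_zero, sub_zero]

theorem shiftProd_neg_one {x : ULoc} {hi : ℤ} {n : ℕ} (h : (hi + 2).toNat = n) :
    shiftProd x (-1) hi = falling (x + 1) n := by
  have h1 : hi + 1 - -1 = hi + 2 := by ring
  rw [shiftProd_eq, h1, h, Int.cast_neg, Int.cast_one, sub_neg_eq_add]

/-- The term of index `β` in the extended sum for `Y_α`. -/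
def yTerm (α β : ℤ × ℤ) : ULoc :=
  ((-1 : ℂ) ^ ((α.1 + α.2) - (β.1 + β.2)) * (binom α β : ℂ)) •
    (toULoc (genL β) * shiftProd (dLoc 0) 0 (α.1 - β.1 - 1) *
      shiftProd (dLoc 1) 0 (α.2 - β.2 - 1) * partialPow β)

theorem yTerm_eq {m n j k : ℕ} (hj : j ≤ m) (hk : k ≤ n) :
    yTerm ((m : ℤ) - 1, (n : ℤ) - 1) ((j : ℤ) - 1, (k : ℤ) - 1) =
      locSystem.L j k * locSystem.coeff m n (j, k) := by
  have e3 : (-1 : ℂ) ^ ((m : ℤ) - 1 + ((n : ℤ) - 1) - ((j : ℤ) - 1 + ((k : ℤ) - 1))) =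
      (-1 : ℂ) ^ (m - j) * (-1 : ℂ) ^ (n - k) := by
    rw [← pow_add, ← zpow_natCast]
    congr 1
    omega
  have e4 : Commute (falling (dLoc 1) (n - k)) ((locSystem.p ^ ((j : ℤ) - 1) : ULocˣ) : ULoc) :=
    (commute_falling (locSystem.pe.units_zpow_left _) _).symm
  have e5 : partialPow ((j : ℤ) - 1, (k : ℤ) - 1) = ((locSystem.p ^ ((j : ℤ) - 1) : ULocˣ) : ULoc) *
      ((locSystem.q ^ ((k : ℤ) - 1) : ULocˣ) : ULoc) := Units.val_mul _ _
  simp only [yTerm, binom, genL_eq_L, sub_add_cancel, Int.toNat_natCast, e3, SBarSystem.coeff,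
    transformCoeff]
  rw [shiftProd_zero (n := m - j) (by omega), shiftProd_zero (n := n - k) (by omega), e5,
    smul_mul_smul_comm, mul_smul_comm]
  congr 1
  · push_cast
    ring
  · change _ = locSystem.L j k * (falling (dLoc 0) (m - j) * _ * (falling (dLoc 1) (n - k) * _))
    simp only [mul_assoc]
    rw [← mul_assoc (falling (dLoc 1) _), e4.eq]
    simp only [mul_assoc]

theorem yTerm_eq_zero {m n : ℕ} {β : ℤ × ℤ} (h : (m : ℤ) - 1 < β.1 ∨ (n : ℤ) - 1 < β.2) :
    yTerm ((m : ℤ) - 1, (n : ℤ) - 1) β = 0 := by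
  have : binom ((m : ℤ) - 1, (n : ℤ) - 1) β = 0 := by
    simp only [binom, sub_add_cancel, Int.toNat_natCast, mul_eq_zero]
    rcases h with h | h
    · exact Or.inl (Nat.choose_eq_zero_of_lt (by omega))
    · exact Or.inr (Nat.choose_eq_zero_of_lt (by omega))
  simp [yTerm, this]

/-- The binomials vanish outside the box j ≤ m, k ≤ n, so any finite index set that contains the box
gives the double transform. -/
theorem sum_yTerm {m n : ℕ} {T : Finset (ℤ × ℤ)}
    (hT : ∀ β ∈ T, -1 ≤ β.1 ∧ -1 ≤ β.2)
    (hT' : ∀ j ≤ m, ∀ k ≤ n, ((j : ℤ) - 1, (k : ℤ) - 1) ∈ T) :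
    ∑ β ∈ T, yTerm ((m : ℤ) - 1, (n : ℤ) - 1) β = locSystem.Y m n := by
  rw [SBarSystem.Y_eq_sum]
  symm
  refine Finset.sum_of_injOn (fun i => ((i.1 : ℤ) - 1, (i.2 : ℤ) - 1)) ?_ ?_ ?_ ?_
  · intro i _ i' _ h
    simp only [Prod.mk.injEq, sub_left_inj, Nat.cast_inj] at h
    exact Prod.ext h.1 h.2
  · intro i hi
    simp only [Finset.coe_product, Set.mem_prod, Finset.mem_coe, Finset.mem_range] at hi
    exact hT' _ (by omega) _ (by omega)
  · intro β hβ hβ'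
    refine yTerm_eq_zero ?_
    by_contra hlt
    have := hT β hβ
    refine hβ' ⟨((β.1 + 1).toNat, (β.2 + 1).toNat), ?_, ?_⟩
    · simp only [Finset.coe_product, Set.mem_prod, Finset.mem_coe, Finset.mem_range]
      omega
    · exact Prod.ext (by simp only; omega) (by simp only; omega)
  · intro i hi
    simp only [Finset.mem_product, Finset.mem_range] at hi
    exact (yTerm_eq (by omega) (by omega)).symm

/-- Write d₁ - d₂ = (d₁ + 1) - (d₂ + 1) and absorb each factor into a falling factorial. The scalar
m n covers the cases in which m - 1 or n - 1 is truncated. -/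
theorem sub_mul_falling (m n : ℕ) :
    ((m : ℂ) * n) • ((dLoc 0 - dLoc 1) * falling (dLoc 0) (m - 1) * falling (dLoc 1) (n - 1)) =
      ((m : ℂ) * n) • (falling (dLoc 0 + 1) m * falling (dLoc 1) (n - 1) -
        falling (dLoc 0) (m - 1) * falling (dLoc 1 + 1) n) := by
  cases m with
  | zero => simp
  | succ m =>
    cases n with
    | zero => simp
    | succ n =>
      have c : Commute (dLoc 1) (falling (dLoc 0) m) := commute_falling locSystem.de.symm m
      rw [falling_add_one, falling_add_one]
      simp only [Nat.add_sub_cancel, sub_mul, add_mul, one_mul, mul_add, mul_assoc]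
      rw [← mul_assoc (dLoc 1), c.eq]
      congr 1
      simp only [mul_assoc]
      abel

/-- Conjugation by ∂₁ or ∂₂ shifts d₁ or d₂ by one, so all three terms are combinations of the same
two products A, B of falling factorials. Up to a common sign they are mn(A - B), mB and -nA, with
sum (m - 1)n A - m(n - 1) B. -/
theorem yTerm_boundary (m n : ℕ) :
    yTerm ((m : ℤ) - 1, (n : ℤ) - 1) 0 + yTerm ((m : ℤ) - 1, (n : ℤ) - 1) (0, -1) +
      yTerm ((m : ℤ) - 1, (n : ℤ) - 1) (-1, 0) =
    ((-1 : ℂ) ^ ((m : ℤ) - 1 + ((n : ℤ) - 1)) * ((((m : ℤ) - 1) * ((n : ℤ) - 1 + 1) : ℤ) : ℂ)) •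
      (shiftProd (dLoc 0) (-1) ((m : ℤ) - 1 - 1) * shiftProd (dLoc 1) 0 ((n : ℤ) - 1 - 1)) +
    ((-1 : ℂ) ^ ((m : ℤ) - 1 + ((n : ℤ) - 1) - 1) *
        ((((m : ℤ) - 1 + 1) * ((n : ℤ) - 1) : ℤ) : ℂ)) •
      (shiftProd (dLoc 0) 0 ((m : ℤ) - 1 - 1) * shiftProd (dLoc 1) (-1) ((n : ℤ) - 1 - 1)) := by
  have hp : toULoc (genL (-1, 0)) = (locSystem.p : ULoc) := by
    have := genL_eq_L 0 1
    rw [locSystem.L_zero_one] at this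
    simpa using this
  have hq : toULoc (genL (0, -1)) = -(locSystem.q : ULoc) := by
    have := genL_eq_L 1 0
    rw [locSystem.L_one_zero] at this
    simpa using this
  have hd : toULoc (genL 0) = dLoc 0 - dLoc 1 := by
    have := genL_eq_L 1 1
    rw [locSystem.L_one_one] at this
    simp only [Nat.cast_one, sub_self] at this
    exact this
  have pp : partialPow (-1, 0) = ((locSystem.p⁻¹ : ULocˣ) : ULoc) := by
    simp [partialPow, locSystem]
  have pq : partialPow (0, -1) = ((locSystem.q⁻¹ : ULocˣ) : ULoc) := by
    simp [partialPow, locSystem]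
  have p0 : partialPow 0 = 1 := by simp [partialPow]
  obtain ⟨ε, hε⟩ : ∃ ε, ε = (-1 : ℂ) ^ ((m : ℤ) - 1 + ((n : ℤ) - 1)) := ⟨_, rfl⟩
  have hm1 : (-1 : ℂ) ≠ 0 := by norm_num
  have h1 : (-1 : ℂ) ^ ((m : ℤ) - 1 + ((n : ℤ) - 1) - 1) = -ε := by
    rw [zpow_sub_one₀ hm1, hε]
    norm_num
  have h2 : (-1 : ℂ) ^ ((m : ℤ) - 1 + ((n : ℤ) - 1) + 1) = -ε := by
    rw [zpow_add_one₀ hm1, hε]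
    norm_num
  have t0 : yTerm ((m : ℤ) - 1, (n : ℤ) - 1) 0 =
      ε • ((m : ℂ) * n) • (falling (dLoc 0 + 1) m * falling (dLoc 1) (n - 1) -
        falling (dLoc 0) (m - 1) * falling (dLoc 1 + 1) n) := by
    rw [← sub_mul_falling, smul_smul, yTerm, hd, p0, mul_one,
      shiftProd_zero (n := m - 1) (by simp only [Prod.fst_zero]; omega),
      shiftProd_zero (n := n - 1) (by simp only [Prod.snd_zero]; omega), hε]
    simp [binom]
  have t1 : yTerm ((m : ℤ) - 1, (n : ℤ) - 1) (0, -1) =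
      ε • (m : ℂ) • (falling (dLoc 0) (m - 1) * falling (dLoc 1 + 1) n) := by
    have c : Commute (locSystem.q : ULoc) (falling (dLoc 0) (m - 1)) :=
      commute_falling locSystem.qd _
    have e : -(locSystem.q : ULoc) * falling (dLoc 0) (m - 1) * falling (dLoc 1) n *
        ((locSystem.q⁻¹ : ULocˣ) : ULoc) =
        -(falling (dLoc 0) (m - 1) * falling (dLoc 1 + 1) n) := by
      have h := mul_falling_eq locSystem.qe n
      change (locSystem.q : ULoc) * falling (dLoc 1) n = falling (dLoc 1 + 1) n * _ at h
      rw [neg_mul, neg_mul, neg_mul, c.eq, mul_assoc _ (locSystem.q : ULoc), h, ← mul_assoc,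
        Units.mul_inv_cancel_right]
    rw [yTerm, hq, pq, shiftProd_zero (n := m - 1) (by simp only; omega),
      shiftProd_zero (n := n) (by simp only; omega), e, smul_neg, smul_smul, ← neg_smul]
    congr 1
    simp only [zero_add, sub_neg_eq_add, h2, binom]
    simp
  have t2 : yTerm ((m : ℤ) - 1, (n : ℤ) - 1) (-1, 0) =
      -(ε • (n : ℂ) • (falling (dLoc 0 + 1) m * falling (dLoc 1) (n - 1))) := by
    have c : Commute (locSystem.p : ULoc) (falling (dLoc 1) (n - 1)) :=
      commute_falling locSystem.pe _
    have e : (locSystem.p : ULoc) * falling (dLoc 0) m * falling (dLoc 1) (n - 1) *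
        ((locSystem.p⁻¹ : ULocˣ) : ULoc) =
        falling (dLoc 0 + 1) m * falling (dLoc 1) (n - 1) := by
      have h := mul_falling_eq locSystem.pd m
      change (locSystem.p : ULoc) * falling (dLoc 0) m = falling (dLoc 0 + 1) m * _ at h
      rw [h, mul_assoc _ (locSystem.p : ULoc), c.eq, ← mul_assoc, Units.mul_inv_cancel_right]
    rw [yTerm, hp, pp, shiftProd_zero (n := m) (by simp only; omega),
      shiftProd_zero (n := n - 1) (by simp only; omega), e, smul_smul, ← neg_smul]
    congr 1
    simp only [add_zero, sub_neg_eq_add, h2, binom]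
    simp
  rw [t0, t1, t2, h1, ← hε, shiftProd_neg_one (n := m) (by omega),
    shiftProd_neg_one (n := n) (by omega), shiftProd_zero (x := dLoc 0) (n := m - 1) (by omega),
    shiftProd_zero (x := dLoc 1) (n := n - 1) (by omega)]
  push_cast
  module

theorem Y_eq (α : YIndex) : Y α.1 = locSystem.Y α.fst α.snd := by
  obtain ⟨m, hm⟩ : ∃ m, m = α.fst := ⟨_, rfl⟩
  obtain ⟨n, hn⟩ : ∃ n, n = α.snd := ⟨_, rfl⟩
  have h1 := α.coe_fst
  have h2 := α.coe_snd
  have h3 := α.two_le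
  have h4 := α.ne_one
  rw [← hm, ← hn] at *
  have hα : α.1 = ((m : ℤ) - 1, (n : ℤ) - 1) := Prod.ext (by simp only; omega) (by simp only; omega)
  rw [hα]
  clear hα h1 h2 hm hn α
  set α : ℤ × ℤ := ((m : ℤ) - 1, (n : ℤ) - 1) with hα
  have hne : ∀ β ∈ lowerSet α, β.1 + β.2 ≠ (m : ℤ) - 1 + ((n : ℤ) - 1) ∧ 0 ≤ β.1 + β.2 ∧ β ≠ 0 := by
    intro β hβ
    rw [mem_lowerSet] at hβ
    refine ⟨ne_of_lt hβ.2.2.2.1, hβ.2.2.1, hβ.2.2.2.2⟩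
  have e1 : ((-1, -1) : ℤ × ℤ) ∉ lowerSet α := fun h => by simpa using (hne _ h).2.1
  have e2 : ((-1, 0) : ℤ × ℤ) ∉ insert ((-1, -1) : ℤ × ℤ) (lowerSet α) := fun h => by
    rcases Finset.mem_insert.1 h with h | h
    · simp at h
    · simpa using (hne _ h).2.1
  have e3 : ((0, -1) : ℤ × ℤ) ∉ insert ((-1, 0) : ℤ × ℤ) (insert (-1, -1) (lowerSet α)) := by
    intro h
    rcases Finset.mem_insert.1 h with h | h
    · simp at h
    rcases Finset.mem_insert.1 h with h | h
    · simp at h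
    · simpa using (hne _ h).2.1
  have e4 : (0 : ℤ × ℤ) ∉ insert ((0, -1) : ℤ × ℤ)
      (insert (-1, 0) (insert (-1, -1) (lowerSet α))) := fun h => by
    rcases Finset.mem_insert.1 h with h | h
    · simp [Prod.ext_iff] at h
    rcases Finset.mem_insert.1 h with h | h
    · simp [Prod.ext_iff] at h
    rcases Finset.mem_insert.1 h with h | h
    · simp [Prod.ext_iff] at h
    · exact (hne _ h).2.2 rfl
  have e5 : α ∉ insert (0 : ℤ × ℤ) (insert (0, -1)
      (insert (-1, 0) (insert (-1, -1) (lowerSet α)))) := fun h => by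
    simp only [Finset.mem_insert] at h
    rcases h with h | h | h | h | h
    · simp only [hα, Prod.ext_iff, Prod.fst_zero, Prod.snd_zero] at h
      omega
    · simp only [hα, Prod.ext_iff] at h
      omega
    · simp only [hα, Prod.ext_iff] at h
      omega
    · simp only [hα, Prod.ext_iff] at h
      omega
    · exact (hne _ h).1 rfl
  -- The box below α meets the complement of `lowerSet α` only in α, in 0, and in the three points
  -- of negative total degree.
  have hsum := sum_yTerm (m := m) (n := n) (T := insert α (insert (0 : ℤ × ℤ) (insert (0, -1)
      (insert (-1, 0) (insert (-1, -1) (lowerSet α)))))) (by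
    intro β hβ
    simp only [Finset.mem_insert, mem_lowerSet] at hβ
    rcases hβ with rfl | rfl | rfl | rfl | rfl | h
    · simp only [hα]; omega
    · simp
    · simp
    · simp
    · simp
    · exact ⟨h.1, h.2.1⟩) (by
    intro j hj k hk
    simp only [Finset.mem_insert, mem_lowerSet, hα, Prod.ext_iff, Prod.fst_zero,
      Prod.snd_zero, ne_eq]
    omega)
  have h00 : yTerm α (-1, -1) = 0 := by
    have := genL_eq_L 0 0
    rw [locSystem.L_zero_zero] at this
    have h : toULoc (genL (-1, -1)) = 0 := by simpa using this
    simp [yTerm, h]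
  have hself : yTerm α α = toULoc (genL α) * partialPow α := by
    rw [yTerm, shiftProd_zero (n := 0) (by simp), shiftProd_zero (n := 0) (by simp)]
    simp [binom, falling]
  rw [Finset.sum_insert e5, Finset.sum_insert e4, Finset.sum_insert e3, Finset.sum_insert e2,
    Finset.sum_insert e1, h00, zero_add, hself] at hsum
  rw [← hsum, Y, add_assoc _ (_ • _) (_ • _), ← yTerm_boundary m n]
  change _ + ∑ β ∈ lowerSet α, yTerm α β + _ = _
  abel

theorem orderedMonomial_eq [LinearOrder YIndex] (s : Multiset YIndex) :
    orderedMonomial s = locSystem.wordY s.sort := by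
  simp only [orderedMonomial, SBarSystem.wordY, Y_eq]

end SBarTwo

end

/-! ### The basis and the generators of H -/

theorem corollary5 [LinearOrder SBarTwo.YIndex] :
    (∃ b : Module.Basis (Multiset SBarTwo.YIndex) ℂ SBarTwo.H,
      ∀ s : Multiset SBarTwo.YIndex, (b s : SBarTwo.ULoc) = SBarTwo.orderedMonomial s) ∧
    Algebra.adjoin ℂ
      ({SBarTwo.Y (1, -1), SBarTwo.Y (-1, 1), SBarTwo.Y (1, 0), SBarTwo.Y (0, 1)} :
        Set SBarTwo.ULoc) = SBarTwo.H := by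
  constructor
  · have hmem : ∀ s : Multiset SBarTwo.YIndex, SBarTwo.orderedMonomial s ∈ SBarTwo.H := fun s => by
      rw [SBarTwo.orderedMonomial_eq]
      exact SBarTwo.locSystem.wordY_mem_Z _
    have hind : LinearIndependent ℂ
        (fun s => (⟨SBarTwo.orderedMonomial s, hmem s⟩ : SBarTwo.H)) := by
      refine LinearIndependent.of_comp SBarTwo.H.val.toLinearMap ?_
      have h := SBarTwo.locSystem.linearIndependent_wordY
        SBarTwo.linearIndependent_wordL_cMonomial
      simp only [← SBarTwo.orderedMonomial_eq] at h
      exact h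
    have hspan : ⊤ ≤ Submodule.span ℂ
        (Set.range fun s => (⟨SBarTwo.orderedMonomial s, hmem s⟩ : SBarTwo.H)) := by
      rintro ⟨u, hu⟩ -
      have h := SBarTwo.locSystem.mem_span_wordY SBarTwo.eq_top_of_L_mem hu
      simp only [← SBarTwo.orderedMonomial_eq] at h
      -- The spanning statement lives in U₍₋₁₎; as the inclusion of H is injective, it pulls back to
      -- H.
      have hmap : Submodule.span ℂ (Set.range SBarTwo.orderedMonomial) =
          (Submodule.span ℂ (Set.range fun s =>
            (⟨SBarTwo.orderedMonomial s, hmem s⟩ : SBarTwo.H))).map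
              SBarTwo.H.val.toLinearMap := by
        rw [Submodule.map_span, ← Set.range_comp]
        rfl
      have h' : u ∈ Submodule.span ℂ (Set.range SBarTwo.orderedMonomial) := h
      rw [hmap] at h'
      obtain ⟨y, hy, hyu⟩ := h'
      have hy' : y = ⟨u, hu⟩ := Subtype.ext hyu
      rwa [← hy']
    exact ⟨Module.Basis.mk hind hspan, fun s => by rw [Module.Basis.mk_apply]⟩
  · have h20 : SBarTwo.Y (1, -1) = SBarTwo.locSystem.Y 2 0 :=
      SBarTwo.Y_eq ⟨(1, -1), by decide⟩
    have h02 : SBarTwo.Y (-1, 1) = SBarTwo.locSystem.Y 0 2 :=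
      SBarTwo.Y_eq ⟨(-1, 1), by decide⟩
    have h21 : SBarTwo.Y (1, 0) = SBarTwo.locSystem.Y 2 1 :=
      SBarTwo.Y_eq ⟨(1, 0), by decide⟩
    have h12 : SBarTwo.Y (0, 1) = SBarTwo.locSystem.Y 1 2 :=
      SBarTwo.Y_eq ⟨(0, 1), by decide⟩
    rw [h20, h02, h21, h12]
    refine SBarTwo.locSystem.eq_Z_of_Y_mem SBarTwo.eq_top_of_L_mem ?_ ?_ ?_ ?_
    · refine Algebra.adjoin_le ?_
      rintro _ (rfl | rfl | rfl | rfl) <;> exact SBarTwo.locSystem.Y_mem_Z _ _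
    all_goals exact Algebra.subset_adjoin (by simp)
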